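/- Let $p>5$, $\gamma<0$ and $\omega>\gamma^2/4$. Let $H^1_{\mathrm{even}}(\mathbb{R})$ be the space of even complex-valued functions in $H^1(\mathbb{R})$ (identified with their continuous representatives). For $f\in H^1(\mathbb{R})$ put \[ \|f\|_{H^1_{\omega,\gamma}}^2:=\|\partial_x f\|_{L^2}^2-\gamma|f(0)|^2+\omega\|f\|_{L^2}^2,\qquad S_{\omega,\gamma}(f):=\tfrac12\|\partial_x f\|_{L^2}^2-\tfrac{\gamma}{2}|f(0)|^2+\tfrac{\omega}{2}\|f\|_{L^2}^2-\tfrac1{p+1}\|f\|_{L^{p+1}}^{p+1}, \] and let \[ Q_{\omega,\gamma}(x):=\left[\frac{(p+1)\omega}{2}\operatorname{sech}^2\left\{\frac{(p-1)\sqrt\omega}{2}|x|+\tanh^{-1}\left(\frac{\gamma}{2\sqrt\omega}\right)\right\}\right]^{\frac1{p-1}},\qquad x\in\mathbb{R}. \] Then $H^1_{\mathrm{even}}(\mathbb{R})\subset L^{p+1}(\mathbb{R})$, $Q_{\omega,\gamma}\in H^1_{\mathrm{even}}(\mathbb{R})$, and there is a smallest constant $C_{\omega,\gamma}$ such that \[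 \|f\|_{L^{p+1}}^2\le C_{\omega,\gamma}\,\|f\|_{H^1_{\omega,\gamma}}^2\qquad\text{for all } f\in H^1_{\mathrm{even}}(\mathbb{R}). \] It is positive, equality holds for $f=Q_{\omega,\gamma}$, and \[ C_{\omega,\gamma}^{-1}=\frac{\|Q_{\omega,\gamma}\|_{H^1_{\omega,\gamma}}^2}{\|Q_{\omega,\gamma}\|_{L^{p+1}}^2} =\left\{\frac{2(p+1)}{p-1}S_{\omega,\gamma}(Q_{\omega,\gamma})\right\}^{\frac{p-1}{p+1}} =\|Q_{\omega,\gamma}\|_{L^{p+1}}^{p-1}. \] -/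

import Mathlib

open MeasureTheory

noncomputable section

namespace DeltaNLS

/-- `g` is the weak derivative of `f` on `ℝ`: both are locally integrable and
`∫ φ' f = - ∫ φ g` for every real test function `φ ∈ C_c^∞(ℝ)`. -/
def HasWeakDeriv (f g : ℝ → ℂ) : Prop :=
  LocallyIntegrable f volume ∧ LocallyIntegrable g volume ∧
    ∀ φ : ℝ → ℝ, ContDiff ℝ (⊤ : ℕ∞) φ → HasCompactSupport φ →
      ∫ x, deriv φ x • f x = -∫ x, φ x • g x

open Classical in
/-- The weak derivative `∂ₓ f` (unique up to a null set), `0` if there is none. -/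
def weakDeriv (f : ℝ → ℂ) : ℝ → ℂ :=
  if h : ∃ g, HasWeakDeriv f g then h.choose else 0

/-- `f` represents an element of the Sobolev space `H¹(ℝ)` of complex-valued functions. -/
def MemH1 (f : ℝ → ℂ) : Prop :=
  MemLp f 2 volume ∧ ∃ g : ℝ → ℂ, MemLp g 2 volume ∧ HasWeakDeriv f g

/-- `f` represents an even element of `H¹(ℝ)`; functions are taken up to null sets. -/
def MemH1Even (f : ℝ → ℂ) : Prop :=
  MemH1 f ∧ ∀ᵐ x : ℝ, f (-x) = f x

open Classical in
/-- The value `f(0)`, taken at the continuous representative of `f` (which is unique, and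
exists for every `f ∈ H¹(ℝ)`); `0` if there is no continuous representative. -/
def valueAtZero (f : ℝ → ℂ) : ℂ :=
  if h : ∃ c : ℝ → ℂ, Continuous c ∧ f =ᵐ[volume] c then h.choose 0 else 0

/-- The norm `‖f‖_{L^q(ℝ)}` for a finite real exponent `q`. -/
def normL (q : ℝ) (f : ℝ → ℂ) : ℝ :=
  lpNorm f (ENNReal.ofReal q) volume

/-- `‖f‖²_{Ḣ¹_γ} = ‖∂ₓ f‖²_{L²} - γ |f(0)|²`. -/
def homNormSq (γ : ℝ) (f : ℝ → ℂ) : ℝ :=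
  normL 2 (weakDeriv f) ^ 2 - γ * ‖valueAtZero f‖ ^ 2

/-- `‖f‖²_{H¹_{ω,γ}} = ‖∂ₓ f‖²_{L²} - γ |f(0)|² + ω ‖f‖²_{L²}`. -/
def energyNormSq (ω γ : ℝ) (f : ℝ → ℂ) : ℝ :=
  homNormSq γ f + ω * normL 2 f ^ 2

/-- The energy `E_γ(f) = ½ ‖f‖²_{Ḣ¹_γ} - (p+1)⁻¹ ‖f‖_{L^{p+1}}^{p+1}`. -/
def energy (p γ : ℝ) (f : ℝ → ℂ) : ℝ :=
  1 / 2 * homNormSq γ f - 1 / (p + 1) * normL (p + 1) f ^ (p + 1)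

/-- The mass `M(f) = ‖f‖²_{L²}`. -/
def mass (f : ℝ → ℂ) : ℝ := normL 2 f ^ 2

/-- The action `S_{ω,γ}(f) = E_γ(f) + (ω/2) M(f)`. -/
def action (p ω γ : ℝ) (f : ℝ → ℂ) : ℝ :=
  energy p γ f + ω / 2 * mass f

/-- The ground state
`Q_{ω,γ}(x) = [ (p+1)ω/2 · sech²( (p-1)√ω/2 · |x| + artanh(γ/(2√ω)) ) ]^{1/(p-1)}`. -/
def groundState (p ω γ : ℝ) (x : ℝ) : ℂ :=
  (((p + 1) * ω / 2 *
      (1 / Real.cosh ((p - 1) * √ω / 2 * |x| + Real.artanh (γ / (2 * √ω)))) ^ 2) ^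
    (1 / (p - 1)) : ℝ)

/-- The constants `C` with `‖f‖²_{L^{p+1}} ≤ C ‖f‖²_{H¹_{ω,γ}}` for all even `f ∈ H¹(ℝ)`. -/
def admissibleConstants (p ω γ : ℝ) : Set ℝ :=
  {C | ∀ f : ℝ → ℂ, MemH1Even f → normL (p + 1) f ^ 2 ≤ C * energyNormSq ω γ f}

end DeltaNLS

end

/-! Put s = √ω and t = γ/(2s), so that |t| < 1. Sharing the point term equally between the two
half-lines, an even function reduces the problem to bounding ∫₀^∞ (|u'|² + s²|u|²) − s t |u(0)|²
below by a multiple of (∫₀^∞ |u|^(p+1))^(2/(p+1)).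

No minimizer is extracted by compactness; the sharp bound comes from a calibration. With α =
(p+1)/(p−1) and b = (p−1)s/2, a soliton φ obeys φ' = −sTφ and T' = b(1−T²), where T is a hyperbolic
tangent, and its remaining mass satisfies b ∫_x^∞ φ^(p+1) = φ(x)^(p+1) · `tailRatio α T`. For an
arbitrary u > 0 on [0, R] with remaining mass m(x), set n = b m / u^(p+1), T = `slope α n` and W = s
u² · `reducedValue α n`. Then u'² + s²u² + W' = (u' + sTu)² ≥ 0, so the energy on [0, R] is at least
W(0) − W(R) (`halfLine_of_pos`). Minimizing over n (`le_reducedValue_sub`) gives the constant; the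
minimum sits at n = `tailRatio α t`, the value for the soliton with T = t at the origin.

Regularization and R → ∞ carry the bound to H¹ (`halfLine`, `even_inequality`). For sharpness, the
energy of Q equals X = ∫ Q^(p+1) (`soliton_energy_identity`), and `halfLineConst_eq` expresses the
half-line constant through the soliton mass, whence C⁻¹ = X^((p−1)/(p+1)). -/

namespace DeltaNLS
open Set Filter Topology

/-! ### The normalized tail integral and its range. -/

/-- The tail integral `∫_t^1 (1 - r²)^(α-1) dr`. -/
noncomputable def tailIntegral (α t : ℝ) : ℝ := ∫ r in t..1, (1 - r ^ 2) ^ (α - 1)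

/-- The normalized tail `(1 - t²)^(-α) ∫_t^1 (1 - r²)^(α-1) dr`. -/
noncomputable def tailRatio (α t : ℝ) : ℝ := (1 - t ^ 2) ^ (-α) * tailIntegral α t

lemma continuous_tail_integrand {α : ℝ} (hα : 1 < α) :
    Continuous fun r : ℝ => (1 - r ^ 2) ^ (α - 1) :=
  (Real.continuous_rpow_const (by linarith)).comp (by fun_prop)

lemma hasDerivAt_tailIntegral {α : ℝ} (hα : 1 < α) (t : ℝ) :
    HasDerivAt (tailIntegral α) (-(1 - t ^ 2) ^ (α - 1)) t :=
  intervalIntegral.integral_hasDerivAt_left ((continuous_tail_integrand hα).intervalIntegrable _ _)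
    ((continuous_tail_integrand hα).stronglyMeasurableAtFilter _ _)
    (continuous_tail_integrand hα).continuousAt

lemma tailIntegral_one (α : ℝ) : tailIntegral α 1 = 0 := by simp [tailIntegral]

lemma one_sub_sq_pos {t : ℝ} (ht : t ∈ Ioo (-1 : ℝ) 1) : 0 < 1 - t ^ 2 := by
  nlinarith [ht.1, ht.2]

lemma hasDerivAt_one_sub_sq_rpow {α : ℝ} (hα : 1 ≤ α) (t : ℝ) :
    HasDerivAt (fun t : ℝ => (1 - t ^ 2) ^ α) (-(2 * α * t) * (1 - t ^ 2) ^ (α - 1)) t := by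
  have h : HasDerivAt (fun t : ℝ => 1 - t ^ 2) (-(2 * t)) t := by
    simpa using (hasDerivAt_pow 2 t).const_sub 1
  convert h.rpow_const (p := α) (Or.inr hα) using 1
  ring

lemma tailIntegral_pos {α t : ℝ} (hα : 1 < α) (ht : t ∈ Ioo (-1 : ℝ) 1) :
    0 < tailIntegral α t := by
  have h : StrictAntiOn (tailIntegral α) (Icc t 1) := by
    apply strictAntiOn_of_deriv_neg (convex_Icc _ _)
    · exact fun x _ => (hasDerivAt_tailIntegral hα x).continuousAt.continuousWithinAt
    · intro x hx
      rw [interior_Icc] at hx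
      rw [(hasDerivAt_tailIntegral hα x).deriv, neg_neg_iff_pos]
      exact Real.rpow_pos_of_pos (one_sub_sq_pos ⟨ht.1.trans hx.1, hx.2⟩) _
  have := h (left_mem_Icc.2 ht.2.le) (right_mem_Icc.2 ht.2.le) ht.2
  rwa [tailIntegral_one] at this

/-- The difference of the two sides vanishes at 1 and has derivative −2α · `tailIntegral`, which is
negative. This is what makes `tailRatio` strictly decreasing. -/
lemma tailIntegral_upper {α t : ℝ} (hα : 1 < α) (ht : t ∈ Ioo (-1 : ℝ) 1) :
    2 * α * t * tailIntegral α t < (1 - t ^ 2) ^ α := by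
  set D : ℝ → ℝ := fun t => (1 - t ^ 2) ^ α - 2 * α * t * tailIntegral α t with hD
  have hd : ∀ x, HasDerivAt D (-(2 * α * tailIntegral α x)) x := fun x => by
    have h1 := (hasDerivAt_one_sub_sq_rpow hα.le x).sub
      ((((hasDerivAt_id x).const_mul (2 * α))).mul (hasDerivAt_tailIntegral hα x))
    refine h1.congr_deriv ?_
    simp only [id]; ring
  have h : StrictAntiOn D (Icc t 1) := by
    apply strictAntiOn_of_deriv_neg (convex_Icc _ _)
    · exact fun x _ => (hd x).continuousAt.continuousWithinAt
    · intro x hx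
      rw [interior_Icc] at hx
      rw [(hd x).deriv, neg_neg_iff_pos]
      have := tailIntegral_pos hα (t := x) ⟨ht.1.trans hx.1, hx.2⟩
      positivity
  have := h (left_mem_Icc.2 ht.2.le) (right_mem_Icc.2 ht.2.le) ht.2
  simp only [hD, tailIntegral_one] at this
  norm_num [Real.zero_rpow (by linarith : α ≠ 0)] at this
  linarith

/-- Same comparison from the endpoint 1, the derivative now carrying the factor 1 − x. It yields
1/(2α) as the infimum of `tailRatio`, the threshold below which `slope` saturates. -/
lemma tailIntegral_lower {α t : ℝ} (hα : 1 < α) (ht : t ∈ Ioo (-1 : ℝ) 1) :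
    (1 - t ^ 2) ^ α < 2 * α * tailIntegral α t := by
  set D : ℝ → ℝ := fun t => 2 * α * tailIntegral α t - (1 - t ^ 2) ^ α with hD
  have hd : ∀ x, HasDerivAt D (-(2 * α * (1 - x) * (1 - x ^ 2) ^ (α - 1))) x := fun x => by
    have h1 := ((hasDerivAt_tailIntegral hα x).const_mul (2 * α)).sub
      (hasDerivAt_one_sub_sq_rpow hα.le x)
    refine h1.congr_deriv ?_
    ring
  have h : StrictAntiOn D (Icc t 1) := by
    apply strictAntiOn_of_deriv_neg (convex_Icc _ _)
    · exact fun x _ => (hd x).continuousAt.continuousWithinAt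
    · intro x hx
      rw [interior_Icc] at hx
      rw [(hd x).deriv, neg_neg_iff_pos]
      have := Real.rpow_pos_of_pos (one_sub_sq_pos ⟨ht.1.trans hx.1, hx.2⟩) (α - 1)
      have : 0 < 1 - x := by linarith [hx.2]
      positivity
  have := h (left_mem_Icc.2 ht.2.le) (right_mem_Icc.2 ht.2.le) ht.2
  simp only [hD, tailIntegral_one] at this
  norm_num [Real.zero_rpow (by linarith : α ≠ 0)] at this
  linarith

lemma tailRatio_pos {α t : ℝ} (hα : 1 < α) (ht : t ∈ Ioo (-1 : ℝ) 1) : 0 < tailRatio α t :=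
  mul_pos (Real.rpow_pos_of_pos (one_sub_sq_pos ht) _) (tailIntegral_pos hα ht)

lemma tailRatio_mul_rpow {α t : ℝ} (ht : t ∈ Ioo (-1 : ℝ) 1) :
    tailRatio α t * (1 - t ^ 2) ^ α = tailIntegral α t := by
  have h := Real.rpow_pos_of_pos (one_sub_sq_pos ht) α
  rw [tailRatio, Real.rpow_neg (one_sub_sq_pos ht).le]
  field_simp

lemma tailRatio_upper {α t : ℝ} (hα : 1 < α) (ht : t ∈ Ioo (-1 : ℝ) 1) :
    2 * α * t * tailRatio α t < 1 := by
  have h := Real.rpow_pos_of_pos (one_sub_sq_pos ht) α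
  have h1 := tailIntegral_upper hα ht
  rw [← tailRatio_mul_rpow ht, ← mul_assoc] at h1
  by_contra! h2
  nlinarith

lemma tailRatio_lower {α t : ℝ} (hα : 1 < α) (ht : t ∈ Ioo (-1 : ℝ) 1) :
    1 / (2 * α) < tailRatio α t := by
  have h := Real.rpow_pos_of_pos (one_sub_sq_pos ht) α
  have h1 := tailIntegral_lower hα ht
  rw [← tailRatio_mul_rpow ht, ← mul_assoc] at h1
  rw [div_lt_iff₀ (by linarith)]
  by_contra! h2
  nlinarith

lemma hasDerivAt_tailRatio {α t : ℝ} (hα : 1 < α) (ht : t ∈ Ioo (-1 : ℝ) 1) :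
    HasDerivAt (tailRatio α) ((-1 + 2 * α * t * tailRatio α t) / (1 - t ^ 2)) t := by
  have h0 := one_sub_sq_pos ht
  have h : HasDerivAt (fun t : ℝ => 1 - t ^ 2) (-(2 * t)) t := by
    simpa using (hasDerivAt_pow 2 t).const_sub 1
  refine ((h.rpow_const (p := -α) (Or.inl h0.ne')).mul (hasDerivAt_tailIntegral hα t)).congr_deriv ?_
  have e1 : (1 - t ^ 2) ^ (-α - 1) = (1 - t ^ 2) ^ (-α) / (1 - t ^ 2) := by
    rw [Real.rpow_sub h0, Real.rpow_one]
  have e2 : (1 - t ^ 2) ^ (-α) * (1 - t ^ 2) ^ (α - 1) = 1 / (1 - t ^ 2) := by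
    rw [← Real.rpow_add h0, one_div, ← Real.rpow_neg_one]; ring_nf
  rw [mul_neg ((1 - t ^ 2) ^ (-α)), e2, e1, tailRatio]
  field_simp
  ring

lemma deriv_tailRatio_neg {α t : ℝ} (hα : 1 < α) (ht : t ∈ Ioo (-1 : ℝ) 1) :
    (-1 + 2 * α * t * tailRatio α t) / (1 - t ^ 2) < 0 :=
  div_neg_of_neg_of_pos (by linarith [tailRatio_upper hα ht]) (one_sub_sq_pos ht)

lemma strictAntiOn_tailRatio {α : ℝ} (hα : 1 < α) :
    StrictAntiOn (tailRatio α) (Ioo (-1) 1) := by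
  apply strictAntiOn_of_deriv_neg (convex_Ioo _ _)
  · exact fun x hx => (hasDerivAt_tailRatio hα hx).continuousAt.continuousWithinAt
  · intro x hx
    rw [interior_Ioo] at hx
    rw [(hasDerivAt_tailRatio hα hx).deriv]
    exact deriv_tailRatio_neg hα hx

/-- Near −1 the prefactor (1 − t²)^(−α) blows up while the tail integral stays at least its value at
0. -/
lemma exists_le_tailRatio {α : ℝ} (hα : 1 < α) (n : ℝ) :
    ∃ t ∈ Ioo (-1 : ℝ) 1, n ≤ tailRatio α t := by
  have h0 : (0 : ℝ) ∈ Ioo (-1 : ℝ) 1 := by norm_num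
  have hI := tailIntegral_pos hα h0
  have h1 : Tendsto (fun t : ℝ => 1 - t ^ 2) (𝓝[>] (-1)) (𝓝[>] 0) := by
    apply tendsto_nhdsWithin_iff.2 ⟨?_, ?_⟩
    · have : ContinuousAt (fun t : ℝ => 1 - t ^ 2) (-1) := by fun_prop
      have h := this.tendsto.mono_left (nhdsWithin_le_nhds (s := Ioi (-1)))
      norm_num at h
      exact h
    · filter_upwards [Ioo_mem_nhdsGT (show (-1 : ℝ) < 0 by norm_num)] with t ht
      exact one_sub_sq_pos ⟨ht.1, ht.2.trans one_pos⟩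
  have h2 := ((tendsto_rpow_neg_nhdsGT_zero (y := -α) (by linarith)).comp h1).atTop_mul_const hI
  have h3 : ∀ᶠ t in 𝓝[>] (-1 : ℝ), t ∈ Ioo (-1 : ℝ) 0 := Ioo_mem_nhdsGT (by norm_num)
  obtain ⟨t, hn, ht⟩ := ((h2.eventually_ge_atTop n).and h3).exists
  refine ⟨t, ⟨ht.1, ht.2.trans one_pos⟩, hn.trans ?_⟩
  apply mul_le_mul_of_nonneg_left _ (Real.rpow_nonneg (one_sub_sq_pos ⟨ht.1, ht.2.trans one_pos⟩).le _)
  rw [tailIntegral, tailIntegral, ← intervalIntegral.integral_add_adjacent_intervals (a := t) (b := 0)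
    ((continuous_tail_integrand hα).intervalIntegrable _ _)
    ((continuous_tail_integrand hα).intervalIntegrable _ _), le_add_iff_nonneg_left]
  apply intervalIntegral.integral_nonneg ht.2.le
  intro r hr
  exact Real.rpow_nonneg (by nlinarith [hr.1, hr.2, ht.1]) _

lemma exists_tailRatio_eq {α n : ℝ} (hα : 1 < α) (hn : 1 / (2 * α) < n) :
    ∃ t ∈ Ioo (-1 : ℝ) 1, tailRatio α t = n := by
  obtain ⟨t₁, h₁, h1⟩ := exists_le_tailRatio hα n
  have hn0 : 0 < n := lt_trans (by positivity) hn
  have ha : 0 < 2 * α := by linarith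
  -- At t = 1/(2αn) the bound `tailRatio_upper` reads `tailRatio α t` < n, giving the lower endpoint
  -- for the intermediate value theorem.
  have h₂ : 1 / (2 * α * n) ∈ Ioo (-1 : ℝ) 1 := by
    rw [div_lt_iff₀ ha] at hn
    refine ⟨lt_trans (by norm_num) (by positivity : (0 : ℝ) < 1 / (2 * α * n)), ?_⟩
    rw [div_lt_one (by positivity)]; linarith
  have h2 : tailRatio α (1 / (2 * α * n)) ≤ n := by
    have := tailRatio_upper hα h₂
    have e : 2 * α * (1 / (2 * α * n)) * tailRatio α (1 / (2 * α * n)) =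
      tailRatio α (1 / (2 * α * n)) / n := by field_simp
    rw [e, div_lt_one hn0] at this
    exact this.le
  have hc : ContinuousOn (tailRatio α) (Ioo (-1) 1) := fun x hx =>
    (hasDerivAt_tailRatio hα hx).continuousAt.continuousWithinAt
  exact (isPreconnected_Ioo.intermediate_value h₂ h₁ hc) ⟨h2, h1⟩

/-! ### The inverse slope and the reduced value function. -/

/-- The slope function: the inverse of `tailRatio α`, extended by `1`. -/
noncomputable def slope (α n : ℝ) : ℝ :=
  open Classical in if h : ∃ t ∈ Ioo (-1 : ℝ) 1, tailRatio α t = n then h.choose else 1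

lemma slope_tailRatio {α t : ℝ} (hα : 1 < α) (ht : t ∈ Ioo (-1 : ℝ) 1) :
    slope α (tailRatio α t) = t := by
  have h : ∃ r ∈ Ioo (-1 : ℝ) 1, tailRatio α r = tailRatio α t := ⟨t, ht, rfl⟩
  rw [slope, dif_pos h]
  exact (strictAntiOn_tailRatio hα).injOn h.choose_spec.1 ht h.choose_spec.2

lemma slope_eq_one {α n : ℝ} (hα : 1 < α) (hn : n ≤ 1 / (2 * α)) : slope α n = 1 := by
  rw [slope, dif_neg]
  rintro ⟨t, ht, rfl⟩
  exact absurd (tailRatio_lower hα ht) (not_lt.2 hn)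

lemma slope_mem_Ioc {α : ℝ} (hα : 1 < α) (n : ℝ) : slope α n ∈ Ioc (-1 : ℝ) 1 := by
  rcases le_or_gt n (1 / (2 * α)) with h | h
  · rw [slope_eq_one hα h]; norm_num
  · obtain ⟨t, ht, rfl⟩ := exists_tailRatio_eq hα h
    rw [slope_tailRatio hα ht]
    exact ⟨ht.1, ht.2.le⟩

lemma antitone_slope {α : ℝ} (hα : 1 < α) : Antitone (slope α) := by
  intro m n hmn
  rcases le_or_gt m (1 / (2 * α)) with h | h
  · rw [slope_eq_one hα h]; exact (slope_mem_Ioc hα n).2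
  · obtain ⟨t, ht, rfl⟩ := exists_tailRatio_eq hα h
    obtain ⟨r, hr, rfl⟩ := exists_tailRatio_eq hα (h.trans_le hmn)
    rw [slope_tailRatio hα ht, slope_tailRatio hα hr]
    exact ((strictAntiOn_tailRatio hα).le_iff_ge ht hr).1 hmn

/-- A monotone surjection onto an interval is continuous. The sign is flipped to get monotonicity,
and the saturated branch supplies the closed endpoint of the range. -/
lemma continuous_slope {α : ℝ} (hα : 1 < α) : Continuous (slope α) := by
  let f : ℝ → Ico (-1 : ℝ) 1 := fun n =>
    ⟨-slope α n, by have := slope_mem_Ioc hα n; exact ⟨by linarith [this.2], by linarith [this.1]⟩⟩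
  have hm : Monotone f := fun m n h => Subtype.mk_le_mk.2 (neg_le_neg (antitone_slope hα h))
  have hs : Function.Surjective f := by
    rintro ⟨t, ht⟩
    rcases eq_or_lt_of_le ht.1 with h | h
    · exact ⟨1 / (2 * α), Subtype.ext (by simp only [f, slope_eq_one hα le_rfl, ← h])⟩
    · exact ⟨tailRatio α (-t), Subtype.ext (by
        simp [f, slope_tailRatio hα (t := -t) ⟨by linarith [ht.2], by linarith⟩])⟩
  have := (continuous_subtype_val.comp (hm.continuous_of_surjective hs)).neg
  exact this.congr fun n => by simp [f]

/-- The reduced value function. -/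
noncomputable def reducedValue (α n : ℝ) : ℝ := slope α n + α * n * (1 - slope α n ^ 2)

lemma reducedValue_zero {α : ℝ} (hα : 1 < α) : reducedValue α 0 = 1 := by
  simp [reducedValue, slope_eq_one hα (n := 0) (by positivity)]

/-- On the inverse branch, slope' · (1 − 2αn · slope) = −(1 − slope²), so differentiating
`reducedValue` leaves (α − 1)(1 − slope²). On the saturated branch both sides are 0. At the junction
the derivative extends by continuity. -/
lemma hasDerivAt_reducedValue {α : ℝ} (hα : 1 < α) (n : ℝ) :
    HasDerivAt (reducedValue α) ((α - 1) * (1 - slope α n ^ 2)) n := by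
  have hcs := continuous_slope hα
  refine hasDerivAt_of_hasDerivAt_of_ne' (x := 1 / (2 * α)) (g := fun n => (α - 1) * (1 - slope α n ^ 2))
    (fun n hn => ?_) ?_ ?_ n
  · rcases lt_or_gt_of_ne hn with h | h
    · rw [slope_eq_one hα h.le]
      have : reducedValue α =ᶠ[𝓝 n] fun _ => 1 := by
        filter_upwards [Iio_mem_nhds h] with m hm
        simp [reducedValue, slope_eq_one hα (le_of_lt hm)]
      simpa using (hasDerivAt_const n (1 : ℝ)).congr_of_eventuallyEq this
    · obtain ⟨t, ht, rfl⟩ := exists_tailRatio_eq hα h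
      have h0 := one_sub_sq_pos ht
      have hd0 := deriv_tailRatio_neg hα ht
      have hT : HasDerivAt (slope α) ((-1 + 2 * α * t * tailRatio α t) / (1 - t ^ 2))⁻¹
          (tailRatio α t) := by
        apply HasDerivAt.of_local_left_inverse (f := tailRatio α) hcs.continuousAt
        · rw [slope_tailRatio hα ht]; exact hasDerivAt_tailRatio hα ht
        · exact hd0.ne
        · filter_upwards [Ioi_mem_nhds h] with m hm
          obtain ⟨r, hr, rfl⟩ := exists_tailRatio_eq hα hm
          rw [slope_tailRatio hα hr]
      have hg := hT.add (((hasDerivAt_id (tailRatio α t)).const_mul α).mul ((hT.pow 2).const_sub 1))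
      refine hg.congr_deriv ?_
      have hne : -1 + 2 * α * t * tailRatio α t ≠ 0 := by
        intro h; rw [h] at hd0; simp at hd0
      simp only [id, Pi.pow_apply, slope_tailRatio hα ht, inv_div]
      generalize tailRatio α t = N at *
      have e : (1 - t ^ 2) / (-1 + 2 * α * t * N) * (-1 + 2 * α * t * N) = 1 - t ^ 2 :=
        div_mul_cancel₀ _ hne
      simp
      linear_combination (-1 : ℝ) * e
  · unfold reducedValue; fun_prop
  · fun_prop

lemma reducedValue_tailRatio {α t : ℝ} (hα : 1 < α) (ht : t ∈ Ioo (-1 : ℝ) 1) :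
    reducedValue α (tailRatio α t) = t + α * tailRatio α t * (1 - t ^ 2) := by
  rw [reducedValue, slope_tailRatio hα ht]

/-- The sharp lower bound of the reduced value function with a boundary penalty `-t`. -/
lemma le_reducedValue_sub {α t n : ℝ} (hα : 1 < α) (ht : t ∈ Ioo (-1 : ℝ) 1) (hn : 0 < n) :
    α * (1 - t ^ 2) * tailRatio α t ^ (1 / α) * n ^ ((α - 1) / α) ≤ reducedValue α n - t := by
  set θ := (α - 1) / α with hθ
  have hθ0 : 0 < θ := div_pos (by linarith) (by linarith)
  set F : ℝ → ℝ := fun n => (reducedValue α n - t) * n ^ (-θ) with hF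
  -- Since θα = α − 1, the terms in 1 − slope² cancel. Only the sign of slope − t remains, so F is
  -- minimal where the slope equals t.
  have hd : ∀ n, 0 < n → HasDerivAt F (-θ * n ^ (-θ - 1) * (slope α n - t)) n := fun n hn => by
    have h := ((hasDerivAt_reducedValue hα n).sub_const t).mul
      (Real.hasDerivAt_rpow_const (p := -θ) (Or.inl hn.ne'))
    refine h.congr_deriv ?_
    have e : n ^ (-θ) = n * n ^ (-θ - 1) := by
      rw [Real.rpow_sub_one hn.ne']; field_simp
    have e2 : θ * α = α - 1 := by rw [hθ]; field_simp
    rw [e, reducedValue]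
    linear_combination (-(n * n ^ (-θ - 1) * (1 - slope α n ^ 2))) * e2
  have hN := tailRatio_pos hα ht
  have key : F (tailRatio α t) ≤ F n := by
    rcases le_total n (tailRatio α t) with h | h
    · have : AntitoneOn F (Icc n (tailRatio α t)) := by
        apply antitoneOn_of_deriv_nonpos (convex_Icc _ _)
        · exact fun x hx => (hd x (hn.trans_le hx.1)).continuousAt.continuousWithinAt
        · intro x hx; rw [interior_Icc] at hx
          exact (hd x (hn.trans hx.1)).differentiableAt.differentiableWithinAt
        · intro x hx; rw [interior_Icc] at hx
          have hx0 := hn.trans hx.1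
          rw [(hd x hx0).deriv]
          have h1 : t ≤ slope α x := by
            have := antitone_slope hα hx.2.le
            rwa [slope_tailRatio hα ht] at this
          have := Real.rpow_pos_of_pos hx0 (-θ - 1)
          have := mul_nonneg (mul_pos hθ0 this).le (sub_nonneg.2 h1)
          linarith
      exact this (left_mem_Icc.2 h) (right_mem_Icc.2 h) h
    · have : MonotoneOn F (Icc (tailRatio α t) n) := by
        apply monotoneOn_of_deriv_nonneg (convex_Icc _ _)
        · exact fun x hx => (hd x (hN.trans_le hx.1)).continuousAt.continuousWithinAt
        · intro x hx; rw [interior_Icc] at hx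
          exact (hd x (hN.trans hx.1)).differentiableAt.differentiableWithinAt
        · intro x hx; rw [interior_Icc] at hx
          have hx0 := hN.trans hx.1
          rw [(hd x hx0).deriv]
          have h1 : slope α x ≤ t := by
            have := antitone_slope hα hx.1.le
            rwa [slope_tailRatio hα ht] at this
          have := Real.rpow_pos_of_pos hx0 (-θ - 1)
          have := mul_nonneg (mul_pos hθ0 this).le (sub_nonneg.2 h1)
          linarith
      exact this (left_mem_Icc.2 h) (right_mem_Icc.2 h) h
  simp only [hF, reducedValue_tailRatio hα ht] at key
  have e : tailRatio α t ^ (1 / α) = tailRatio α t * tailRatio α t ^ (-θ) := by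
    rw [← Real.rpow_one_add' hN.le]
    · congr 1; rw [hθ]; field_simp; ring
    · rw [hθ]; field_simp; simp; linarith
  have hn' := Real.rpow_pos_of_pos hn θ
  have e3 : n ^ (-θ) * n ^ θ = 1 := by rw [← Real.rpow_add hn]; simp
  calc _ = ((t + α * tailRatio α t * (1 - t ^ 2) - t) * tailRatio α t ^ (-θ)) * n ^ θ := by
        rw [e]; ring
    _ ≤ ((reducedValue α n - t) * n ^ (-θ)) * n ^ θ := mul_le_mul_of_nonneg_right key hn'.le
    _ = _ := by rw [mul_assoc, e3, mul_one]

/-! ### The calibrated inequality on a bounded interval. -/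

/-- The sharp constant of the half-line inequality with boundary slope `t`. -/
noncomputable def halfLineConst (p s t : ℝ) : ℝ :=
  s * ((p + 1) / (p - 1) * (1 - t ^ 2) *
    tailRatio ((p + 1) / (p - 1)) t ^ (1 / ((p + 1) / (p - 1)))) *
    ((p - 1) * s / 2) ^ (2 / (p + 1))

lemma halfLineConst_pos {p s t : ℝ} (hp : 1 < p) (hs : 0 < s) (ht : t ∈ Ioo (-1 : ℝ) 1) :
    0 < halfLineConst p s t := by
  have hα : 1 < (p + 1) / (p - 1) := by rw [lt_div_iff₀ (by linarith)]; linarith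
  have h1 := Real.rpow_pos_of_pos (tailRatio_pos hα ht) (1 / ((p + 1) / (p - 1)))
  have h2 := Real.rpow_pos_of_pos (by nlinarith : 0 < (p - 1) * s / 2) (2 / (p + 1))
  have h3 := one_sub_sq_pos ht
  unfold halfLineConst
  positivity

/-- The sharp inequality for positive `C¹` functions on `[0, R]`, proved by calibration with the
value function `(a, m) ↦ s a² g(b m / a^(p+1))`. -/
lemma halfLine_of_pos {p s t R : ℝ} (hp : 1 < p) (hs : 0 < s) (ht : t ∈ Ioo (-1 : ℝ) 1)
    (hR : 0 < R) {u u' : ℝ → ℝ} (hu : ∀ x, HasDerivAt u (u' x) x) (hu' : Continuous u')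
    (hpos : ∀ x, 0 < u x) :
    halfLineConst p s t * (∫ x in 0..R, u x ^ (p + 1)) ^ (2 / (p + 1)) ≤
      (∫ x in 0..R, (u' x ^ 2 + s ^ 2 * u x ^ 2)) + s * u R ^ 2 - s * t * u 0 ^ 2 := by
  have hp1 : 0 < p - 1 := by linarith
  have hpp : 0 < p + 1 := by linarith
  have hα : 1 < (p + 1) / (p - 1) := by rw [lt_div_iff₀ hp1]; linarith
  set α := (p + 1) / (p - 1) with hαd
  set b := (p - 1) * s / 2 with hb
  have hb0 : 0 < b := by positivity
  have huc : Continuous u := continuous_iff_continuousAt.2 fun x => (hu x).continuousAt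
  have hupc : Continuous fun x => u x ^ (p + 1) :=
    huc.rpow_const fun x => Or.inl (hpos x).ne'
  set m : ℝ → ℝ := fun x => ∫ y in x..R, u y ^ (p + 1) with hm
  have hmd : ∀ x, HasDerivAt m (-(u x ^ (p + 1))) x := fun x =>
    intervalIntegral.integral_hasDerivAt_left (hupc.intervalIntegrable _ _)
      (hupc.stronglyMeasurableAtFilter _ _) hupc.continuousAt
  set n : ℝ → ℝ := fun x => b * (m x * u x ^ (-(p + 1))) with hn
  have hnd : ∀ x, HasDerivAt n (-b - (p + 1) * n x * u' x / u x) x := fun x => by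
    have h := ((hmd x).mul ((hu x).rpow_const (p := -(p + 1)) (Or.inl (hpos x).ne'))).const_mul b
    refine h.congr_deriv ?_
    have e1 : u x ^ (p + 1) * u x ^ (-(p + 1)) = 1 := by
      rw [← Real.rpow_add (hpos x)]; simp
    have e2 : u x ^ (-(p + 1) - 1) = u x ^ (-(p + 1)) / u x := Real.rpow_sub_one (hpos x).ne' _
    rw [e2]
    simp only [hn]
    linear_combination (-b) * e1
  have hnc : Continuous n := continuous_iff_continuousAt.2 fun x => (hnd x).continuousAt
  have hTc : Continuous fun x => slope α (n x) := (continuous_slope hα).comp hnc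
  set W : ℝ → ℝ := fun x => s * (u x ^ 2 * reducedValue α (n x)) with hW
  have hWd : ∀ x, HasDerivAt W (2 * s * u x * u' x * slope α (n x) -
      s ^ 2 * u x ^ 2 * (1 - slope α (n x) ^ 2)) x := fun x => by
    have h := (((hu x).pow 2).mul ((hasDerivAt_reducedValue hα (n x)).comp x (hnd x))).const_mul s
    refine h.congr_deriv ?_
    have hux := (hpos x).ne'
    have ea : (α - 1) * b = s := by rw [hαd, hb]; field_simp; ring
    have ec : (α - 1) * (p + 1) = 2 * α := by rw [hαd]; field_simp; ring
    simp only [Function.comp, reducedValue, Pi.pow_apply]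
    set T := slope α (n x)
    have e3 : u x ^ 2 * ((α - 1) * (1 - T ^ 2) * (-b - (p + 1) * n x * u' x / u x)) =
        -(u x ^ 2 * (1 - T ^ 2) * ((α - 1) * b)) -
          ((α - 1) * (p + 1)) * (1 - T ^ 2) * n x * u' x * u x := by
      field_simp
    rw [e3, ea, ec]
    norm_num
    ring
  have hWc : Continuous fun x => 2 * s * u x * u' x * slope α (n x) -
      s ^ 2 * u x ^ 2 * (1 - slope α (n x) ^ 2) := by fun_prop
  have hFTC := intervalIntegral.integral_eq_sub_of_hasDerivAt (a := 0) (b := R)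
    (fun x _ => hWd x) (hWc.intervalIntegrable _ _)
  have hEc : Continuous fun x => u' x ^ 2 + s ^ 2 * u x ^ 2 := by fun_prop
  have hsum := intervalIntegral.integral_add (a := 0) (b := R) (μ := volume)
    (hEc.intervalIntegrable _ _) (hWc.intervalIntegrable _ _)
  have hnonneg : 0 ≤ ∫ x in 0..R, ((u' x ^ 2 + s ^ 2 * u x ^ 2) +
      (2 * s * u x * u' x * slope α (n x) - s ^ 2 * u x ^ 2 * (1 - slope α (n x) ^ 2))) := by
    apply intervalIntegral.integral_nonneg hR.le
    intro x _
    -- The integrand is exactly this square.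
    nlinarith [sq_nonneg (u' x + s * u x * slope α (n x))]
  rw [hsum, hFTC] at hnonneg
  -- No mass remains at R, so n(R) = 0 and the reduced value is 1.
  have hWR : W R = s * u R ^ 2 := by
    simp [hW, hn, hm, reducedValue_zero hα]
  have hm0 : 0 < m 0 := intervalIntegral.intervalIntegral_pos_of_pos
    (hupc.intervalIntegrable _ _) (fun x => Real.rpow_pos_of_pos (hpos x) _) hR
  have hu0 := hpos 0
  have hup := Real.rpow_pos_of_pos hu0 (-(p + 1))
  have hn0 : 0 < n 0 := by simp only [hn]; positivity
  have hlow := le_reducedValue_sub hα ht hn0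
  have hθ : (α - 1) / α = 2 / (p + 1) := by rw [hαd]; field_simp; ring
  rw [hθ] at hlow
  -- The exponent 2/(p+1) is the one for which the powers of u(0) cancel, leaving only the mass.
  have hpow : u 0 ^ 2 * n 0 ^ (2 / (p + 1)) = b ^ (2 / (p + 1)) * m 0 ^ (2 / (p + 1)) := by
    simp only [hn]
    rw [Real.mul_rpow hb0.le (mul_pos hm0 hup).le, Real.mul_rpow hm0.le hup.le,
      ← Real.rpow_mul hu0.le]
    have : -(p + 1) * (2 / (p + 1)) = -2 := by field_simp
    rw [this, Real.rpow_neg hu0.le]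
    have : u 0 ^ (2 : ℝ) = u 0 ^ 2 := by norm_num
    rw [this]
    field_simp
  have hfin : halfLineConst p s t * m 0 ^ (2 / (p + 1)) ≤ W 0 - s * t * u 0 ^ 2 := by
    calc _ = s * u 0 ^ 2 * (α * (1 - t ^ 2) * tailRatio α t ^ (1 / α) * n 0 ^ (2 / (p + 1))) := by
          rw [halfLineConst, ← hαd, ← hb]
          linear_combination (-(s * (α * (1 - t ^ 2) * tailRatio α t ^ (1 / α)))) * hpow
      _ ≤ s * u 0 ^ 2 * (reducedValue α (n 0) - t) := mul_le_mul_of_nonneg_left hlow (by positivity)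
      _ = _ := by simp only [hW]; ring
  linarith

/-- The sharp inequality for complex-valued `C¹` functions on `[0, R]`. -/
lemma halfLine_of_contDiff {p s t R : ℝ} (hp : 1 < p) (hs : 0 < s) (ht : t ∈ Ioo (-1 : ℝ) 1)
    (hR : 0 < R) {c g : ℝ → ℂ} (hc : ∀ x, HasDerivAt c (g x) x) (hg : Continuous g) :
    halfLineConst p s t * (∫ x in 0..R, ‖c x‖ ^ (p + 1)) ^ (2 / (p + 1)) ≤
      (∫ x in 0..R, ‖g x‖ ^ 2) + s ^ 2 * (∫ x in 0..R, ‖c x‖ ^ 2) +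
        s * ‖c R‖ ^ 2 - s * t * ‖c 0‖ ^ 2 := by
  have hcc : Continuous c := continuous_iff_continuousAt.2 fun x => (hc x).continuousAt
  have key : ∀ ε : ℝ, 0 < ε →
      halfLineConst p s t * (∫ x in 0..R, ‖c x‖ ^ (p + 1)) ^ (2 / (p + 1)) ≤
      (∫ x in 0..R, ‖g x‖ ^ 2) + s ^ 2 * (∫ x in 0..R, ‖c x‖ ^ 2) +
        s * ‖c R‖ ^ 2 - s * t * ‖c 0‖ ^ 2 + (s ^ 2 * R + s - s * t) * ε := by
    intro ε hε
    -- The regularized modulus is positive and C¹ even at zeros of c, and its derivative is bounded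
    -- by ‖g‖; the phase of c is discarded.
    set u : ℝ → ℝ := fun x => √(‖c x‖ ^ 2 + ε) with hu
    have hup : ∀ x, 0 < u x := fun x => Real.sqrt_pos.2 (by positivity)
    have hu2 : ∀ x, u x ^ 2 = ‖c x‖ ^ 2 + ε := fun x => Real.sq_sqrt (by positivity)
    have huc : Continuous u := by simp only [hu]; fun_prop
    set u' : ℝ → ℝ := fun x => 2 * inner ℝ (c x) (g x) / (2 * u x) with hu'
    have hud : ∀ x, HasDerivAt u (u' x) x := fun x => by
      have h1 := ((hc x).norm_sq).add_const ε
      exact h1.sqrt (by positivity)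
    have hu'c : Continuous u' := by
      simp only [hu']
      exact (continuous_const.mul (hcc.inner hg)).div (continuous_const.mul huc)
        fun x => by have := hup x; positivity
    have hbd : ∀ x, u' x ^ 2 ≤ ‖g x‖ ^ 2 := fun x => by
      have h1 := abs_real_inner_le_norm (c x) (g x)
      have h2 : u' x = inner ℝ (c x) (g x) / u x := by
        simp only [hu']; have := (hup x).ne'; field_simp
      have h3 : ‖c x‖ ≤ u x := Real.le_sqrt_of_sq_le (by linarith)
      rw [h2, sq_le_sq, abs_norm, abs_div, abs_of_pos (hup x), div_le_iff₀ (hup x)]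
      nlinarith [norm_nonneg (g x)]
    have h := halfLine_of_pos hp hs ht hR hud hu'c hup
    have hcp : Continuous fun x => ‖c x‖ ^ (p + 1) :=
      hcc.norm.rpow_const fun x => Or.inr (by linarith)
    have hle : (∫ x in 0..R, ‖c x‖ ^ (p + 1)) ≤ ∫ x in 0..R, u x ^ (p + 1) := by
      apply intervalIntegral.integral_mono_on hR.le (hcp.intervalIntegrable _ _)
        ((huc.rpow_const fun x => Or.inl (hup x).ne').intervalIntegrable _ _)
      intro x _
      exact Real.rpow_le_rpow (norm_nonneg _) (Real.le_sqrt_of_sq_le (by linarith)) (by linarith)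
    have hle2 : (∫ x in 0..R, (u' x ^ 2 + s ^ 2 * u x ^ 2)) ≤
        (∫ x in 0..R, ‖g x‖ ^ 2) + s ^ 2 * (∫ x in 0..R, ‖c x‖ ^ 2) + s ^ 2 * R * ε := by
      have e : (∫ x in 0..R, ‖g x‖ ^ 2) + s ^ 2 * (∫ x in 0..R, ‖c x‖ ^ 2) + s ^ 2 * R * ε =
          ∫ x in 0..R, (‖g x‖ ^ 2 + (s ^ 2 * ‖c x‖ ^ 2 + s ^ 2 * ε)) := by
        have i1 : Continuous fun x => ‖g x‖ ^ 2 := by fun_prop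
        have i2 : Continuous fun x => s ^ 2 * ‖c x‖ ^ 2 := by fun_prop
        have i3 : Continuous fun x => s ^ 2 * ‖c x‖ ^ 2 + s ^ 2 * ε := by fun_prop
        rw [intervalIntegral.integral_add (i1.intervalIntegrable _ _) (i3.intervalIntegrable _ _),
          intervalIntegral.integral_add (i2.intervalIntegrable _ _)
            (continuous_const.intervalIntegrable _ _), intervalIntegral.integral_const_mul,
          intervalIntegral.integral_const]
        simp only [smul_eq_mul]; ring
      rw [e]
      apply intervalIntegral.integral_mono_on hR.le
        ((by fun_prop : Continuous _).intervalIntegrable _ _)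
        ((by fun_prop : Continuous _).intervalIntegrable _ _)
      intro x _
      rw [hu2]
      linarith [hbd x]
    have hK := halfLineConst_pos hp hs ht
    have h0 : 0 ≤ ∫ x in 0..R, ‖c x‖ ^ (p + 1) :=
      intervalIntegral.integral_nonneg hR.le fun x _ => by positivity
    have h1 := mul_le_mul_of_nonneg_left
      (Real.rpow_le_rpow h0 hle (by have : 0 < p + 1 := by linarith
                                    positivity : 0 ≤ 2 / (p + 1))) hK.le
    rw [hu2, hu2] at h
    linarith
  have hB : 0 < s ^ 2 * R + s - s * t := by
    have : 0 < s * (1 - t) := mul_pos hs (by linarith [ht.2])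
    have : 0 < s ^ 2 * R := by positivity
    linarith
  apply le_of_forall_pos_le_add
  intro η hη
  have := key (η / (s ^ 2 * R + s - s * t)) (by positivity)
  rwa [mul_div_cancel₀ _ hB.ne'] at this

/-! ### From C¹ functions to square integrable derivatives, and to the half-line. -/

/-- The primitive of `g` with value `a` at `0`. -/
noncomputable def primitive (a : ℂ) (g : ℝ → ℂ) (x : ℝ) : ℂ := a + ∫ y in 0..x, g y

lemma primitive_zero (a : ℂ) (g : ℝ → ℂ) : primitive a g 0 = a := by simp [primitive]

lemma intervalIntegrable_of_locallyIntegrable {g : ℝ → ℂ} (hg : LocallyIntegrable g volume)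
    (a b : ℝ) : IntervalIntegrable g volume a b :=
  (hg.integrableOn_isCompact isCompact_uIcc).intervalIntegrable

lemma continuous_primitive {g : ℝ → ℂ} (hg : LocallyIntegrable g volume) (a : ℂ) :
    Continuous (primitive a g) :=
  continuous_const.add (intervalIntegral.continuous_primitive
    (intervalIntegrable_of_locallyIntegrable hg) 0)

lemma primitive_neg (a : ℂ) (g : ℝ → ℂ) (x : ℝ) :
    primitive a g (-x) = primitive a (fun y => -g (-y)) x := by
  have := intervalIntegral.integral_comp_neg (a := 0) (b := x) g
  rw [primitive, primitive, intervalIntegral.integral_neg, this, neg_zero,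
    ← intervalIntegral.integral_symm]

lemma normL_rpow {f : ℝ → ℂ} (hf : AEStronglyMeasurable f volume) {q : ℝ} (hq : 0 < q) :
    normL q f ^ q = ∫ x, ‖f x‖ ^ q := by
  have h := lpNorm_eq_integral_norm_rpow_toReal (p := ENNReal.ofReal q) (by simpa using hq)
    ENNReal.ofReal_ne_top hf
  rw [ENNReal.toReal_ofReal hq.le] at h
  rw [normL, h, ← Real.rpow_mul (integral_nonneg fun x => by positivity), inv_mul_cancel₀ hq.ne',
    Real.rpow_one]

lemma normL_two_sq {f : ℝ → ℂ} (hf : AEStronglyMeasurable f volume) :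
    normL 2 f ^ 2 = ∫ x, ‖f x‖ ^ 2 := by
  have := normL_rpow hf two_pos
  simpa using this

lemma _root_.MeasureTheory.MemLp.integrable_norm_sq {f : ℝ → ℂ} (hf : MemLp f 2 volume) :
    Integrable (fun x => ‖f x‖ ^ 2) := by
  simpa using hf.integrable_norm_pow (p := 2) (by norm_num)

lemma exists_continuous_approx {g : ℝ → ℂ} (hg : MemLp g 2 volume) {ε : ℝ} (hε : 0 < ε) :
    ∃ k : ℝ → ℂ, Continuous k ∧ MemLp k 2 volume ∧ ∫ x, ‖g x - k x‖ ^ 2 ≤ ε ^ 2 := by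
  obtain ⟨k, -, hk, hkc, hkm⟩ := hg.exists_hasCompactSupport_eLpNorm_sub_le (by norm_num)
    (ε := ENNReal.ofReal ε) (by simpa using hε)
  refine ⟨k, hkc, hkm, ?_⟩
  have hm := (hg.sub hkm).aestronglyMeasurable
  have h := normL_two_sq hm
  simp only [Pi.sub_apply] at h
  rw [← h]
  have h2 : normL 2 (g - k) ≤ ε := by
    rw [normL, ← toReal_eLpNorm hm]
    apply ENNReal.toReal_le_of_le_ofReal hε.le
    simpa using hk
  exact pow_le_pow_left₀ lpNorm_nonneg h2 2

/-- The sharp inequality on `[0, R]` for primitives of square integrable functions. -/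
lemma halfLine_of_memLp {p s t R : ℝ} (hp : 1 < p) (hs : 0 < s) (ht : t ∈ Ioo (-1 : ℝ) 1)
    (hR : 0 < R) (a : ℂ) {g : ℝ → ℂ} (hg : MemLp g 2 volume) :
    halfLineConst p s t * (∫ x in 0..R, ‖primitive a g x‖ ^ (p + 1)) ^ (2 / (p + 1)) ≤
      (∫ x in 0..R, ‖g x‖ ^ 2) + s ^ 2 * (∫ x in 0..R, ‖primitive a g x‖ ^ 2) +
        s * ‖primitive a g R‖ ^ 2 - s * t * ‖a‖ ^ 2 := by
  set ε : ℕ → ℝ := fun n => 1 / ((n : ℝ) + 1) with hε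
  have hε0 : ∀ n, 0 < ε n := fun n => by simp only [hε]; positivity
  have hεlim : Tendsto ε atTop (𝓝 0) := tendsto_one_div_add_atTop_nhds_zero_nat
  choose k hkc hkm hk using fun n => exists_continuous_approx hg (hε0 n)
  have hgl := hg.locallyIntegrable (by norm_num)
  have hcc := continuous_primitive hgl a
  have hknc : ∀ n, Continuous (primitive a (k n)) := fun n =>
    continuous_primitive (hkc n).locallyIntegrable a
  have hL2 := hg.integrable_norm_sq
  have hD : ∀ n, Integrable fun x => ‖g x - k n x‖ ^ 2 := fun n =>
    (hg.sub (hkm n)).integrable_norm_sq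
  have hset : ∀ n, ∫ x in 0..R, ‖g x - k n x‖ ^ 2 ≤ ε n ^ 2 := fun n => by
    rw [intervalIntegral.integral_of_le hR.le]
    exact (setIntegral_le_integral (hD n) (Eventually.of_forall fun x => by positivity)).trans (hk n)
  have hclose : ∀ n, ∀ x ∈ Icc 0 R, ‖primitive a g x - primitive a (k n) x‖ ≤ (R + 1) / 2 * ε n := by
    intro n x hx
    have hi := intervalIntegrable_of_locallyIntegrable (hgl.sub (hkc n).locallyIntegrable)
    have e : primitive a g x - primitive a (k n) x = ∫ y in 0..x, (g y - k n y) := by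
      rw [intervalIntegral.integral_sub (intervalIntegrable_of_locallyIntegrable hgl _ _)
        ((hkc n).intervalIntegrable _ _), primitive, primitive]
      ring
    rw [e]
    calc _ ≤ ∫ y in 0..x, ‖g y - k n y‖ := intervalIntegral.norm_integral_le_integral_norm hx.1
      _ ≤ ∫ y in 0..R, ‖g y - k n y‖ :=
        intervalIntegral.integral_mono_interval le_rfl hx.1 hx.2
          (Eventually.of_forall fun y => norm_nonneg _) (hi 0 R).norm
      -- The inequality d ≤ ε/2 + d²/(2ε) plays the role of Cauchy–Schwarz: a squared L² error ε²
      -- becomes a uniform error linear in ε.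
      _ ≤ ∫ y in 0..R, (ε n / 2 + (1 / (2 * ε n)) * ‖g y - k n y‖ ^ 2) := by
        apply intervalIntegral.integral_mono_on hR.le (hi 0 R).norm
          (intervalIntegrable_const.add ((hD n).intervalIntegrable.const_mul _))
        intro y _
        have h0 := hε0 n
        rw [Pi.sub_apply]
        have : ε n / 2 + (1 / (2 * ε n)) * ‖g y - k n y‖ ^ 2 - ‖g y - k n y‖ =
          (‖g y - k n y‖ - ε n) ^ 2 / (2 * ε n) := by field_simp; ring
        have : 0 ≤ (‖g y - k n y‖ - ε n) ^ 2 / (2 * ε n) := by positivity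
        linarith
      _ = R * (ε n / 2) + (1 / (2 * ε n)) * ∫ y in 0..R, ‖g y - k n y‖ ^ 2 := by
        rw [intervalIntegral.integral_add intervalIntegrable_const
          ((hD n).intervalIntegrable.const_mul _), intervalIntegral.integral_const,
          intervalIntegral.integral_const_mul]
        simp
      _ ≤ R * (ε n / 2) + (1 / (2 * ε n)) * ε n ^ 2 := by
        have h0 := hε0 n
        have := mul_le_mul_of_nonneg_left (hset n) (by positivity : 0 ≤ 1 / (2 * ε n))
        linarith
      _ = _ := by have h0 := (hε0 n).ne'; field_simp
  have hlimx : ∀ x ∈ Icc 0 R, Tendsto (fun n => primitive a (k n) x) atTop (𝓝 (primitive a g x)) := by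
    intro x hx
    rw [tendsto_iff_norm_sub_tendsto_zero]
    refine squeeze_zero (fun n => norm_nonneg _) (fun n => ?_)
      (by simpa using hεlim.const_mul ((R + 1) / 2))
    rw [norm_sub_rev]; exact hclose n x hx
  obtain ⟨B, hB⟩ := (isCompact_Icc (a := 0) (b := R)).exists_bound_of_continuousOn hcc.continuousOn
  have hBn : ∀ n, ∀ x ∈ Icc 0 R, ‖primitive a (k n) x‖ ≤ B + (R + 1) / 2 := by
    intro n x hx
    have h1 := hclose n x hx
    have h2 : ε n ≤ 1 := by
      simp only [hε]; rw [div_le_one (by positivity)]; linarith [(Nat.cast_nonneg n : (0 : ℝ) ≤ n)]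
    have h3 : (R + 1) / 2 * ε n ≤ (R + 1) / 2 := by nlinarith
    have h4 := norm_sub_norm_le (primitive a (k n) x) (primitive a g x)
    rw [norm_sub_rev] at h4
    linarith [hB x hx]
  have hpow : ∀ q : ℝ, 0 < q → Tendsto (fun n => ∫ x in 0..R, ‖primitive a (k n) x‖ ^ q) atTop
      (𝓝 (∫ x in 0..R, ‖primitive a g x‖ ^ q)) := by
    intro q hq
    apply intervalIntegral.tendsto_integral_filter_of_dominated_convergence
      (fun _ => (B + (R + 1) / 2) ^ q)
    · exact Eventually.of_forall fun n =>
        ((hknc n).norm.rpow_const fun x => Or.inr hq.le).aestronglyMeasurable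
    · refine Eventually.of_forall fun n => Eventually.of_forall fun x hx => ?_
      rw [uIoc_of_le hR.le] at hx
      rw [Real.norm_of_nonneg (by positivity)]
      exact Real.rpow_le_rpow (norm_nonneg _) (hBn n x (Ioc_subset_Icc_self hx)) hq.le
    · exact intervalIntegrable_const
    · refine Eventually.of_forall fun x hx => ?_
      rw [uIoc_of_le hR.le] at hx
      exact (hlimx x (Ioc_subset_Icc_self hx)).norm.rpow_const (Or.inr hq.le)
  have hsq := hpow 2 two_pos
  simp only [Real.rpow_two] at hsq
  -- Young's inequality with weight ε: the error (1 + 1/ε)ε² = ε² + ε still tends to 0.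
  have hgk : ∀ n, ∫ x in 0..R, ‖k n x‖ ^ 2 ≤
      (1 + ε n) * (∫ x in 0..R, ‖g x‖ ^ 2) + (1 + 1 / ε n) * ε n ^ 2 := by
    intro n
    have h0 := hε0 n
    calc _ ≤ ∫ x in 0..R, ((1 + ε n) * ‖g x‖ ^ 2 + (1 + 1 / ε n) * ‖g x - k n x‖ ^ 2) := by
          apply intervalIntegral.integral_mono_on hR.le (hkm n).integrable_norm_sq.intervalIntegrable
            ((hL2.intervalIntegrable.const_mul _).add ((hD n).intervalIntegrable.const_mul _))
          intro x _
          have h1 : ‖k n x‖ ≤ ‖g x‖ + ‖g x - k n x‖ := by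
            have := norm_sub_norm_le (k n x) (g x)
            rw [norm_sub_rev] at this; linarith
          have h2 : (1 + ε n) * ‖g x‖ ^ 2 + (1 + 1 / ε n) * ‖g x - k n x‖ ^ 2 -
            (‖g x‖ + ‖g x - k n x‖) ^ 2 = (ε n * ‖g x‖ - ‖g x - k n x‖) ^ 2 / ε n := by
              field_simp; ring
          have h3 : 0 ≤ (ε n * ‖g x‖ - ‖g x - k n x‖) ^ 2 / ε n := by positivity
          have := pow_le_pow_left₀ (norm_nonneg _) h1 2
          linarith
      _ = (1 + ε n) * (∫ x in 0..R, ‖g x‖ ^ 2) +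
          (1 + 1 / ε n) * ∫ x in 0..R, ‖g x - k n x‖ ^ 2 := by
          rw [intervalIntegral.integral_add (hL2.intervalIntegrable.const_mul _)
            ((hD n).intervalIntegrable.const_mul _), intervalIntegral.integral_const_mul,
            intervalIntegral.integral_const_mul]
      _ ≤ _ := by
          have := mul_le_mul_of_nonneg_left (hset n) (by positivity : 0 ≤ 1 + 1 / ε n)
          linarith
  have hkey : ∀ n, halfLineConst p s t *
      (∫ x in 0..R, ‖primitive a (k n) x‖ ^ (p + 1)) ^ (2 / (p + 1)) ≤
      ((1 + ε n) * (∫ x in 0..R, ‖g x‖ ^ 2) + (ε n ^ 2 + ε n)) +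
        s ^ 2 * (∫ x in 0..R, ‖primitive a (k n) x‖ ^ 2) +
        s * ‖primitive a (k n) R‖ ^ 2 - s * t * ‖a‖ ^ 2 := by
    intro n
    have h := halfLine_of_contDiff hp hs ht hR (c := primitive a (k n)) (g := k n) (fun x =>
      (intervalIntegral.integral_hasDerivAt_right ((hkc n).intervalIntegrable _ _)
        ((hkc n).stronglyMeasurableAtFilter _ _) (hkc n).continuousAt).const_add a) (hkc n)
    rw [primitive_zero] at h
    have h1 := hgk n
    have h0 := (hε0 n).ne'
    have h2 : (1 + 1 / ε n) * ε n ^ 2 = ε n ^ 2 + ε n := by field_simp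
    rw [h2] at h1
    linarith
  have hθ : 0 ≤ 2 / (p + 1) := div_nonneg two_pos.le (by linarith)
  refine le_of_tendsto_of_tendsto
    (((hpow (p + 1) (by linarith)).rpow_const (Or.inr hθ)).const_mul _) ?_
    (Eventually.of_forall hkey)
  refine Tendsto.sub_const (Tendsto.add (Tendsto.add ?_ (hsq.const_mul _))
    (((hlimx R (right_mem_Icc.2 hR.le)).norm.pow 2).const_mul _)) _
  have h1 := ((hεlim.const_add 1).mul_const (∫ x in 0..R, ‖g x‖ ^ 2)).add ((hεlim.pow 2).add hεlim)
  simpa using h1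

/-- Otherwise ‖c‖² would exceed a positive level on a whole ray, a set of infinite measure,
contradicting Chebyshev. Along such R the boundary term s‖c(R)‖² disappears. -/
lemma exists_seq_tendsto_zero {c : ℝ → ℂ} (hc : MemLp c 2 volume) :
    ∃ R : ℕ → ℝ, (∀ n : ℕ, (n : ℝ) + 1 ≤ R n) ∧ ∀ n : ℕ, ‖c (R n)‖ ^ 2 ≤ 1 / ((n : ℝ) + 1) := by
  suffices h : ∀ n : ℕ, ∃ R : ℝ, (n : ℝ) + 1 ≤ R ∧ ‖c R‖ ^ 2 ≤ 1 / ((n : ℝ) + 1) by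
    choose R hR using h
    exact ⟨R, fun n => (hR n).1, fun n => (hR n).2⟩
  intro n
  by_contra! h
  have h1 := hc.integrable_norm_sq.measure_ge_lt_top (ε := 1 / ((n : ℝ) + 1)) (by positivity)
  have h2 : volume (Ici ((n : ℝ) + 1)) ≤ volume {x | 1 / ((n : ℝ) + 1) ≤ ‖c x‖ ^ 2} :=
    measure_mono fun x hx => (h x hx).le
  rw [Real.volume_Ici] at h2
  exact absurd (h2.trans_lt h1) (by simp)

/-- The sharp half-line inequality, including the integrability of `‖c‖^(p+1)`. -/
lemma halfLine {p s t : ℝ} (hp : 1 < p) (hs : 0 < s) (ht : t ∈ Ioo (-1 : ℝ) 1)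
    (a : ℂ) {g : ℝ → ℂ} (hg : MemLp g 2 volume) (hc : MemLp (primitive a g) 2 volume) :
    IntegrableOn (fun x => ‖primitive a g x‖ ^ (p + 1)) (Ioi 0) ∧
    halfLineConst p s t * (∫ x in Ioi 0, ‖primitive a g x‖ ^ (p + 1)) ^ (2 / (p + 1)) ≤
      (∫ x in Ioi 0, ‖g x‖ ^ 2) + s ^ 2 * (∫ x in Ioi 0, ‖primitive a g x‖ ^ 2) -
        s * t * ‖a‖ ^ 2 := by
  obtain ⟨R, hR1, hRc⟩ := exists_seq_tendsto_zero hc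
  have hR0 : ∀ n, 0 < R n := fun n => lt_of_lt_of_le (by positivity) (hR1 n)
  have hRlim : Tendsto R atTop atTop :=
    tendsto_atTop_mono hR1 (tendsto_natCast_atTop_atTop.atTop_add tendsto_const_nhds)
  have hK := halfLineConst_pos hp hs ht
  have hθ : 0 < 2 / (p + 1) := div_pos two_pos (by linarith)
  have hcc := continuous_primitive (hg.locallyIntegrable (by norm_num)) a
  have hcp : Continuous fun x => ‖primitive a g x‖ ^ (p + 1) :=
    hcc.norm.rpow_const fun x => Or.inr (by linarith)
  have hkey := fun n => halfLine_of_memLp hp hs ht (hR0 n) a hg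
  have hG := hg.integrable_norm_sq
  have hC := hc.integrable_norm_sq
  have hint : IntegrableOn (fun x => ‖primitive a g x‖ ^ (p + 1)) (Ioi 0) := by
    -- A bound uniform in n: integrals over the whole line replace those over [0, R n], and ‖c(R
    -- n)‖² ≤ 1 accounts for the lone summand s.
    set Y := ((∫ x, ‖g x‖ ^ 2) + s ^ 2 * (∫ x, ‖primitive a g x‖ ^ 2) + s - s * t * ‖a‖ ^ 2) /
      halfLineConst p s t with hY
    apply integrableOn_Ioi_of_intervalIntegral_norm_bounded (Y ^ (2 / (p + 1))⁻¹) 0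
      (fun n => (hcp.locallyIntegrable.integrableOn_isCompact isCompact_Icc).mono_set
        Ioc_subset_Icc_self) hRlim
    refine Eventually.of_forall fun n => ?_
    have e : ∀ x, ‖‖primitive a g x‖ ^ (p + 1)‖ = ‖primitive a g x‖ ^ (p + 1) := fun x =>
      Real.norm_of_nonneg (by positivity)
    simp only [e]
    have h0 : 0 ≤ ∫ x in 0..R n, ‖primitive a g x‖ ^ (p + 1) :=
      intervalIntegral.integral_nonneg (hR0 n).le fun x _ => by positivity
    have h1 : (∫ x in 0..R n, ‖primitive a g x‖ ^ (p + 1)) ^ (2 / (p + 1)) ≤ Y := by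
      rw [hY, le_div_iff₀ hK, mul_comm]
      refine (hkey n).trans ?_
      have i1 : (∫ x in 0..R n, ‖g x‖ ^ 2) ≤ ∫ x, ‖g x‖ ^ 2 := by
        rw [intervalIntegral.integral_of_le (hR0 n).le]
        exact setIntegral_le_integral hG (Eventually.of_forall fun x => by positivity)
      have i2 : (∫ x in 0..R n, ‖primitive a g x‖ ^ 2) ≤ ∫ x, ‖primitive a g x‖ ^ 2 := by
        rw [intervalIntegral.integral_of_le (hR0 n).le]
        exact setIntegral_le_integral hC (Eventually.of_forall fun x => by positivity)
      have i3 : ‖primitive a g (R n)‖ ^ 2 ≤ 1 := (hRc n).trans (by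
        rw [div_le_one (by positivity)]; linarith [(Nat.cast_nonneg n : (0 : ℝ) ≤ n)])
      have := mul_le_mul_of_nonneg_left i2 (sq_nonneg s)
      have := mul_le_mul_of_nonneg_left i3 hs.le
      linarith
    calc _ = ((∫ x in 0..R n, ‖primitive a g x‖ ^ (p + 1)) ^ (2 / (p + 1))) ^ (2 / (p + 1))⁻¹ := by
          rw [← Real.rpow_mul h0, mul_inv_cancel₀ hθ.ne', Real.rpow_one]
      _ ≤ _ := Real.rpow_le_rpow (by positivity) h1 (by positivity)
  refine ⟨hint, ?_⟩
  have hlim := ((intervalIntegral_tendsto_integral_Ioi 0 hint hRlim).rpow_const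
    (Or.inr hθ.le)).const_mul (halfLineConst p s t)
  have hzero : Tendsto (fun n => ‖primitive a g (R n)‖ ^ 2) atTop (𝓝 0) :=
    squeeze_zero (fun n => by positivity) hRc tendsto_one_div_add_atTop_nhds_zero_nat
  have hlim2 := (((intervalIntegral_tendsto_integral_Ioi 0 hG.integrableOn hRlim).add
    ((intervalIntegral_tendsto_integral_Ioi 0 hC.integrableOn hRlim).const_mul (s ^ 2))).add
    (hzero.const_mul s)).sub_const (s * t * ‖a‖ ^ 2)
  rw [mul_zero, add_zero] at hlim2
  exact le_of_tendsto_of_tendsto hlim hlim2 (Eventually.of_forall hkey)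

/-! ### Weak derivatives and primitives in one dimension. -/

lemma integral_deriv_mul_primitive {h φ : ℝ → ℝ} (hh : LocallyIntegrable h volume) (a : ℝ)
    (hφ : ContDiff ℝ (⊤ : ℕ∞) φ) {A : ℝ} (hA : 0 < A) (hφA : ∀ x, A ≤ |x| → φ x = 0) :
    ∫ x in (-A)..A, deriv φ x * (a + ∫ y in 0..x, h y) = -∫ x in (-A)..A, φ x * h x := by
  have hi : ∀ u v, IntervalIntegrable h volume u v := fun u v =>
    (hh.integrableOn_isCompact isCompact_uIcc).intervalIntegrable
  have hac : AbsolutelyContinuousOnInterval (fun x => a + ∫ y in 0..x, h y) (-A) A := by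
    have h1 := (hi (-A) A).absolutelyContinuousOnInterval_intervalIntegral (c := 0)
      (by rw [uIcc_of_le (by linarith)]; constructor <;> linarith)
    have h2 : AbsolutelyContinuousOnInterval (fun _ : ℝ => a) (-A) A :=
      (contDiff_const.contDiffOn (n := 1)).absolutelyContinuousOnInterval
    exact h2.add h1
  have hφac : AbsolutelyContinuousOnInterval φ (-A) A :=
    ((hφ.of_le (by norm_cast)).contDiffOn (n := 1)).absolutelyContinuousOnInterval
  have hparts := hφac.integral_mul_deriv_eq_deriv_mul hac
  rw [hφA A (by rw [abs_of_pos hA]), hφA (-A) (by rw [abs_neg, abs_of_pos hA])] at hparts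
  have e : ∫ x in (-A)..A, φ x * deriv (fun x => a + ∫ y in 0..x, h y) x =
      ∫ x in (-A)..A, φ x * h x := by
    apply intervalIntegral.integral_congr_ae
    filter_upwards [LocallyIntegrable.ae_hasDerivAt_integral hh] with x hx _
    rw [((hx 0).const_add a).deriv]
  rw [e] at hparts
  rw [hparts]
  ring

lemma exists_tsupport_subset_Ioo {φ : ℝ → ℝ} (hcs : HasCompactSupport φ) :
    ∃ A : ℝ, 0 < A ∧ tsupport φ ⊆ Ioo (-A) A := by
  obtain ⟨A, hA⟩ := hcs.isCompact.isBounded.subset_ball 0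
  refine ⟨max A 1, by positivity, hA.trans ?_⟩
  rw [Real.ball_eq_Ioo]
  exact Ioo_subset_Ioo (by simp) (by simp)

lemma hasWeakDeriv_primitive {g : ℝ → ℂ} (hg : LocallyIntegrable g volume) (a : ℂ) :
    HasWeakDeriv (primitive a g) g := by
  have hc := continuous_primitive hg a
  refine ⟨hc.locallyIntegrable, hg, fun φ hφ hcs => ?_⟩
  obtain ⟨A, hA, hsub⟩ := exists_tsupport_subset_Ioo hcs
  have hφA : ∀ x, A ≤ |x| → φ x = 0 := fun x hx => by
    by_contra hne
    have := hsub (subset_tsupport _ hne)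
    exact absurd (abs_lt.2 this) (not_lt.2 hx)
  have hφc := hφ.continuous
  have hφ'c : Continuous (deriv φ) := hφ.continuous_deriv (by norm_cast)
  have s1 : Function.support (fun x => deriv φ x • primitive a g x) ⊆ Ioc (-A) A := by
    intro x hx
    have : deriv φ x ≠ 0 := fun h0 => hx (by simp [h0])
    exact Ioo_subset_Ioc_self (hsub (support_deriv_subset this))
  have s2 : Function.support (fun x => φ x • g x) ⊆ Ioc (-A) A := by
    intro x hx
    have : φ x ≠ 0 := fun h0 => hx (by simp [h0])
    exact Ioo_subset_Ioc_self (hsub (subset_tsupport _ this))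
  rw [← intervalIntegral.integral_eq_integral_of_support_subset s1,
    ← intervalIntegral.integral_eq_integral_of_support_subset s2]
  have hgi := intervalIntegrable_of_locallyIntegrable hg
  have i1 : IntervalIntegrable (fun x => deriv φ x • primitive a g x) volume (-A) A :=
    (hφ'c.smul hc).intervalIntegrable _ _
  have i2 : IntervalIntegrable (fun x => φ x • g x) volume (-A) A :=
    (hgi _ _).continuousOn_smul hφc.continuousOn
  -- Integration by parts is real-valued, so it is applied to the real and imaginary parts through
  -- L.
  have comp : ∀ L : ℂ →L[ℝ] ℝ, L (∫ x in (-A)..A, deriv φ x • primitive a g x) =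
      L (-∫ x in (-A)..A, φ x • g x) := by
    intro L
    have hL : LocallyIntegrable (fun x => L (g x)) volume := fun x => by
      obtain ⟨u, hu, hi⟩ := hg x
      exact ⟨u, hu, L.integrable_comp hi⟩
    rw [map_neg, ← L.intervalIntegral_comp_comm i1, ← L.intervalIntegral_comp_comm i2]
    have := integral_deriv_mul_primitive hL (L a) hφ hA hφA
    simpa only [primitive, map_smul, map_add, smul_eq_mul,
      ← L.intervalIntegral_comp_comm (hgi _ _)] using this
  exact Complex.ext (comp Complex.reCLM) (comp Complex.imCLM)

lemma integrable_smul_of_hasCompactSupport {f : ℝ → ℂ} (hf : LocallyIntegrable f volume)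
    {φ : ℝ → ℝ} (hφ : Continuous φ) (hcs : HasCompactSupport φ) :
    Integrable (fun x => φ x • f x) :=
  hf.integrable_smul_left_of_hasCompactSupport hφ hcs

lemma HasWeakDeriv.ae_unique {f g h : ℝ → ℂ} (hg : HasWeakDeriv f g) (hh : HasWeakDeriv f h) :
    g =ᵐ[volume] h :=
  ae_eq_of_integral_contDiff_smul_eq hg.2.1 hh.2.1 fun φ hφ hcs =>
    neg_injective ((hg.2.2 φ hφ hcs).symm.trans (hh.2.2 φ hφ hcs))

lemma HasWeakDeriv.congr_left {f f' g : ℝ → ℂ} (hg : HasWeakDeriv f g) (h : f =ᵐ[volume] f') :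
    HasWeakDeriv f' g := by
  refine ⟨?_, hg.2.1, fun φ hφ hcs => ?_⟩
  · intro x
    obtain ⟨u, hu, hi⟩ := hg.1 x
    exact ⟨u, hu, hi.congr (ae_restrict_of_ae h)⟩
  · rw [← hg.2.2 φ hφ hcs]
    apply integral_congr_ae
    filter_upwards [h] with x hx
    rw [hx]

/-- The zero mean makes the primitive vanish to the right of the support as well, so it is again a
test function. -/
lemma exists_antideriv_of_integral_eq_zero {η : ℝ → ℝ} (hη : ContDiff ℝ (⊤ : ℕ∞) η)
    (hcs : HasCompactSupport η) (h0 : ∫ x, η x = 0) :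
    ∃ φ : ℝ → ℝ, ContDiff ℝ (⊤ : ℕ∞) φ ∧ HasCompactSupport φ ∧ deriv φ = η := by
  obtain ⟨A, hA, hsub⟩ := exists_tsupport_subset_Ioo hcs
  have hz : ∀ x, x ∉ Ioo (-A) A → η x = 0 := fun x hx => by
    by_contra hne
    exact hx (hsub (subset_tsupport _ hne))
  have hc := hη.continuous
  set φ : ℝ → ℝ := fun x => ∫ y in (-A)..x, η y with hφ
  have hd : ∀ x, HasDerivAt φ (η x) x := fun x =>
    intervalIntegral.integral_hasDerivAt_right (hc.intervalIntegrable _ _)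
      (hc.stronglyMeasurableAtFilter _ _) hc.continuousAt
  have hderiv : deriv φ = η := funext fun x => (hd x).deriv
  refine ⟨φ, ?_, ?_, hderiv⟩
  · rw [contDiff_infty_iff_deriv, hderiv]
    exact ⟨fun x => (hd x).differentiableAt, hη⟩
  · refine HasCompactSupport.of_support_subset_isCompact (isCompact_Icc (a := -A) (b := A)) ?_
    intro x hx
    by_contra hn
    apply hx
    rcases lt_or_ge x (-A) with h | h
    · simp only [hφ]
      rw [intervalIntegral.integral_congr (g := fun _ => 0), intervalIntegral.integral_zero]
      intro y hy
      rw [uIcc_of_ge h.le] at hy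
      exact hz y fun hy' => absurd hy'.1 (not_lt.2 hy.2)
    · have hxA : A < x := by
        by_contra! h2; exact hn ⟨h, h2⟩
      have hs : Function.support η ⊆ Ioc (-A) x := fun y hy => by
        have := hsub (subset_tsupport _ hy)
        exact ⟨this.1, (this.2.trans hxA).le⟩
      simp only [hφ]
      rw [intervalIntegral.integral_eq_integral_of_support_subset hs, h0]

/-- A function with vanishing weak derivative is constant. -/
lemma ae_const_of_hasWeakDeriv_zero {f : ℝ → ℂ} (hf : HasWeakDeriv f 0) :
    ∃ k : ℂ, ∀ᵐ x, f x = k := by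
  let bump : ContDiffBump (0 : ℝ) := ⟨1, 2, one_pos, one_lt_two⟩
  set ρ : ℝ → ℝ := bump.normed volume with hρ
  have hρd : ContDiff ℝ (⊤ : ℕ∞) ρ := bump.contDiff_normed
  have hρs : HasCompactSupport ρ := bump.hasCompactSupport_normed
  have hρ1 : ∫ x, ρ x = 1 := bump.integral_normed
  refine ⟨∫ x, ρ x • f x, ae_eq_of_integral_contDiff_smul_eq hf.1
    (continuous_const.locallyIntegrable) fun ψ hψ hψs => ?_⟩
  set k := ∫ x, ψ x with hk
  have hi1 := hψ.continuous.integrable_of_hasCompactSupport hψs (μ := volume)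
  have hi2 := hρd.continuous.integrable_of_hasCompactSupport hρs (μ := volume)
  -- Du Bois-Reymond: subtracting k times a unit-mass bump makes ψ the derivative of a test
  -- function, hence invisible to f.
  obtain ⟨φ, hφ, hφs, hφd⟩ := exists_antideriv_of_integral_eq_zero
    (η := fun x => ψ x - k * ρ x) (hψ.sub (contDiff_const.mul hρd))
    (hψs.sub (hρs.mul_left)) (by
      rw [integral_sub hi1 (hi2.const_mul k), integral_const_mul, hρ1, hk]; ring)
  have h := hf.2.2 φ hφ hφs
  rw [hφd] at h
  have j1 := integrable_smul_of_hasCompactSupport hf.1 hψ.continuous hψs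
  have j2 := integrable_smul_of_hasCompactSupport hf.1 hρd.continuous hρs
  have e : ∀ x, (ψ x - k * ρ x) • f x = ψ x • f x - k • (ρ x • f x) := fun x => by
    rw [sub_smul, mul_smul]
  simp only [e, Pi.zero_apply, smul_zero, integral_zero, neg_zero] at h
  rw [integral_sub j1 (j2.fun_smul k), integral_smul, sub_eq_zero] at h
  rw [h, integral_smul_const]

lemma HasWeakDeriv.exists_primitive {f g : ℝ → ℂ} (hf : HasWeakDeriv f g) :
    ∃ a : ℂ, f =ᵐ[volume] primitive a g := by
  have hP := hasWeakDeriv_primitive hf.2.1 0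
  have h0 : HasWeakDeriv (f - primitive 0 g) 0 := by
    refine ⟨hf.1.sub hP.1, locallyIntegrable_zero, fun φ hφ hcs => ?_⟩
    have hφ'c : Continuous (deriv φ) := hφ.continuous_deriv (by norm_cast)
    have j1 := integrable_smul_of_hasCompactSupport hf.1 hφ'c hcs.deriv
    have j2 := integrable_smul_of_hasCompactSupport hP.1 hφ'c hcs.deriv
    simp only [Pi.sub_apply, smul_sub, Pi.zero_apply, smul_zero, integral_zero, neg_zero]
    rw [integral_sub j1 j2, hf.2.2 φ hφ hcs, hP.2.2 φ hφ hcs, sub_self]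
  obtain ⟨a, ha⟩ := ae_const_of_hasWeakDeriv_zero h0
  refine ⟨a, ?_⟩
  filter_upwards [ha] with x hx
  simp only [Pi.sub_apply, primitive, zero_add, sub_eq_iff_eq_add] at hx
  simpa [primitive] using hx

lemma weakDeriv_ae_eq {f g : ℝ → ℂ} (hf : HasWeakDeriv f g) : weakDeriv f =ᵐ[volume] g := by
  have h : ∃ g, HasWeakDeriv f g := ⟨g, hf⟩
  rw [weakDeriv, dif_pos h]
  exact h.choose_spec.ae_unique hf

/-- Two continuous functions equal almost everywhere are equal, so the chosen representative is
immaterial. -/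
lemma valueAtZero_eq {f c : ℝ → ℂ} (hc : Continuous c) (hfc : f =ᵐ[volume] c) :
    valueAtZero f = c 0 := by
  have h : ∃ c : ℝ → ℂ, Continuous c ∧ f =ᵐ[volume] c := ⟨c, hc, hfc⟩
  rw [valueAtZero, dif_pos h]
  have := (h.choose_spec.1.ae_eq_iff_eq volume hc).1 (h.choose_spec.2.symm.trans hfc)
  rw [this]

lemma normL_congr {f g : ℝ → ℂ} (hfg : f =ᵐ[volume] g) (q : ℝ) : normL q f = normL q g := by
  by_cases hf : AEStronglyMeasurable f volume
  · rw [normL, normL, ← toReal_eLpNorm hf, ← toReal_eLpNorm (hf.congr hfg), eLpNorm_congr_ae hfg]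
  · have hg : ¬ AEStronglyMeasurable g volume := fun h => hf (h.congr hfg.symm)
    rw [normL, normL, lpNorm_of_not_aestronglyMeasurable hf,
      lpNorm_of_not_aestronglyMeasurable hg]

lemma memH1_primitive {a : ℂ} {g : ℝ → ℂ} (hg : MemLp g 2 volume)
    (hc : MemLp (primitive a g) 2 volume) : MemH1 (primitive a g) :=
  ⟨hc, g, hg, hasWeakDeriv_primitive (hg.locallyIntegrable (by norm_num)) a⟩

lemma MemH1.exists_primitive {f : ℝ → ℂ} (hf : MemH1 f) :
    ∃ (a : ℂ) (g : ℝ → ℂ), MemLp g 2 volume ∧ MemLp (primitive a g) 2 volume ∧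
      f =ᵐ[volume] primitive a g := by
  obtain ⟨hf2, g, hg, hw⟩ := hf
  obtain ⟨a, ha⟩ := hw.exists_primitive
  exact ⟨a, g, hg, hf2.ae_eq ha, ha⟩

lemma energyNormSq_of_ae_eq_primitive {ω γ : ℝ} {f : ℝ → ℂ} {a : ℂ} {g : ℝ → ℂ}
    (hg : MemLp g 2 volume) (h : f =ᵐ[volume] primitive a g) :
    energyNormSq ω γ f = (∫ x, ‖g x‖ ^ 2) - γ * ‖a‖ ^ 2 + ω * ∫ x, ‖primitive a g x‖ ^ 2 := by
  have hgl := hg.locallyIntegrable (by norm_num)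
  have hc := continuous_primitive hgl a
  have hw := (hasWeakDeriv_primitive hgl a).congr_left h.symm
  rw [energyNormSq, homNormSq, normL_congr (weakDeriv_ae_eq hw), normL_congr h,
    valueAtZero_eq hc h, normL_two_sq hg.aestronglyMeasurable,
    normL_two_sq hc.aestronglyMeasurable, primitive_zero]

/-! ### Even functions as two copies of the half-line problem. -/

lemma integral_eq_add_reflect {h : ℝ → ℝ} (hh : Integrable h) :
    ∫ x, h x = (∫ x in Ioi 0, h x) + ∫ x in Ioi 0, h (-x) := by
  rw [← intervalIntegral.integral_Iic_add_Ioi hh.integrableOn hh.integrableOn (b := 0),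
    integral_comp_neg_Ioi, neg_zero, add_comm]

lemma integrable_of_even {h : ℝ → ℝ} (he : ∀ x, h (-x) = h x) (hi : IntegrableOn h (Ioi 0)) :
    Integrable h := by
  rw [← integrableOn_univ, ← Iic_union_Ioi (a := (0 : ℝ))]
  refine IntegrableOn.union ?_ hi
  have h1 : IntegrableOn h (Ici (-0)) := by
    rw [neg_zero]; exact (integrableOn_Ici_iff_integrableOn_Ioi (by simp)).2 hi
  simpa [he] using h1.comp_neg_Iic

/-- Membership in `L^(p+1)` and the sharp inequality for even `H¹` functions. -/
lemma even_inequality {p s t : ℝ} (hp : 1 < p) (hs : 0 < s) (ht : t ∈ Ioo (-1 : ℝ) 1)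
    {f : ℝ → ℂ} (hf : MemH1Even f) :
    MemLp f (ENNReal.ofReal (p + 1)) volume ∧
    2 * halfLineConst p s t * ((∫ x, ‖f x‖ ^ (p + 1)) / 2) ^ (2 / (p + 1)) ≤
      energyNormSq (s ^ 2) (2 * s * t) f := by
  obtain ⟨a, g, hg, hc, h⟩ := hf.1.exists_primitive
  have hgl := hg.locallyIntegrable (by norm_num)
  have hcc := continuous_primitive hgl a
  have hneg : Measure.QuasiMeasurePreserving (Neg.neg : ℝ → ℝ) volume volume :=
    (Measure.measurePreserving_neg volume).quasiMeasurePreserving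
  have heven : ∀ x, primitive a g (-x) = primitive a g x := by
    have h1 : (fun x => primitive a g (-x)) =ᵐ[volume] primitive a g := by
      filter_upwards [h, hneg.ae h, hf.2] with x h1 h2 h3
      rw [← h1, ← h2, h3]
    have := (Continuous.ae_eq_iff_eq volume (hcc.comp continuous_neg) hcc).1 h1
    exact fun x => congrFun this x
  have hg' : MemLp (fun y => -g (-y)) 2 volume :=
    (hg.comp_measurePreserving (Measure.measurePreserving_neg volume)).neg
  -- By evenness the left half-line carries the same primitive, with derivative −g(−y); no evenness
  -- or oddness of g itself has to be proved.
  have hpe : primitive a (fun y => -g (-y)) = primitive a g :=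
    funext fun x => by rw [← primitive_neg, heven]
  have hR := halfLine hp hs ht a hg hc
  have hL := halfLine hp hs ht a hg' (by rwa [hpe])
  rw [hpe] at hL
  simp only [norm_neg] at hL
  have hint : Integrable fun x => ‖primitive a g x‖ ^ (p + 1) :=
    integrable_of_even (fun x => by simp only [heven]) hR.1
  have hp1 : 0 < p + 1 := by linarith
  have hmem : MemLp (primitive a g) (ENNReal.ofReal (p + 1)) volume := by
    rw [← integrable_norm_rpow_iff hcc.aestronglyMeasurable (by simpa using hp1)
      ENNReal.ofReal_ne_top, ENNReal.toReal_ofReal hp1.le]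
    exact hint
  refine ⟨hmem.ae_eq h.symm, ?_⟩
  have e0 : ∫ x, ‖f x‖ ^ (p + 1) = ∫ x, ‖primitive a g x‖ ^ (p + 1) := by
    apply integral_congr_ae
    filter_upwards [h] with x hx
    rw [hx]
  have e1 := integral_eq_add_reflect hint
  have e2 := integral_eq_add_reflect hc.integrable_norm_sq
  have e3 := integral_eq_add_reflect hg.integrable_norm_sq
  simp only [heven] at e1 e2
  rw [energyNormSq_of_ae_eq_primitive hg h, e0, e1, e2, e3]
  have e4 : ∀ X : ℝ, (X + X) / 2 = X := fun X => by ring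
  rw [e4]
  linarith [hR.2, hL.2]

/-! ### The soliton on the half-line and its exact integrals. -/

lemma tanh_mem_Ioo (x : ℝ) : Real.tanh x ∈ Ioo (-1 : ℝ) 1 :=
  Real.tanh_bijOn.mapsTo (mem_univ x)

lemma one_sub_tanh_sq (x : ℝ) : 1 - Real.tanh x ^ 2 = (1 / Real.cosh x) ^ 2 := by
  have h := (Real.cosh_pos x).ne'
  have h1 := Real.cosh_sq x
  rw [Real.tanh_eq_sinh_div_cosh]
  field_simp
  linarith

lemma hasDerivAt_tanh (x : ℝ) : HasDerivAt Real.tanh (1 - Real.tanh x ^ 2) x := by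
  have h := (Real.cosh_pos x).ne'
  have h1 := (Real.hasDerivAt_sinh x).div (Real.hasDerivAt_cosh x) h
  have e : Real.sinh / Real.cosh = Real.tanh := funext fun y => (Real.tanh_eq_sinh_div_cosh y).symm
  rw [e] at h1
  refine h1.congr_deriv ?_
  rw [Real.tanh_eq_sinh_div_cosh]
  field_simp

lemma monotone_tanh : Monotone Real.tanh :=
  monotone_of_hasDerivAt_nonneg hasDerivAt_tanh fun x => (one_sub_sq_pos (tanh_mem_Ioo x)).le

/-- The shifted soliton profile on the line. -/
noncomputable def soliton (p s a x : ℝ) : ℝ :=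
  ((p + 1) * s ^ 2 / 2 * (1 / Real.cosh ((p - 1) * s / 2 * x + a)) ^ 2) ^ (1 / (p - 1))

/-- The hyperbolic tangent occurring in the logarithmic derivative of the soliton. -/
noncomputable def solitonTanh (p s a x : ℝ) : ℝ := Real.tanh ((p - 1) * s / 2 * x + a)

section soliton

variable {p s : ℝ} (a : ℝ)

lemma solitonTanh_zero : solitonTanh p s a 0 = Real.tanh a := by simp [solitonTanh]

lemma solitonTanh_mem_Ioo (x : ℝ) : solitonTanh p s a x ∈ Ioo (-1 : ℝ) 1 := tanh_mem_Ioo _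

lemma soliton_eq (p s a x : ℝ) : soliton p s a x =
    ((p + 1) * s ^ 2 / 2 * (1 - solitonTanh p s a x ^ 2)) ^ (1 / (p - 1)) := by
  rw [soliton, solitonTanh, one_sub_tanh_sq]

lemma hasDerivAt_solitonTanh (x : ℝ) : HasDerivAt (solitonTanh p s a)
    ((p - 1) * s / 2 * (1 - solitonTanh p s a x ^ 2)) x := by
  have h1 : HasDerivAt (fun x => (p - 1) * s / 2 * x + a) ((p - 1) * s / 2) x := by
    simpa using ((hasDerivAt_id x).const_mul ((p - 1) * s / 2)).add_const a
  refine ((hasDerivAt_tanh _).comp x h1).congr_deriv ?_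
  rw [solitonTanh]; ring

lemma continuous_solitonTanh : Continuous (solitonTanh p s a) :=
  continuous_iff_continuousAt.2 fun x => (hasDerivAt_solitonTanh a x).continuousAt

lemma soliton_base_pos (hp : 1 < p) (hs : 0 < s) (x : ℝ) :
    0 < (p + 1) * s ^ 2 / 2 * (1 - solitonTanh p s a x ^ 2) := by
  have := one_sub_sq_pos (solitonTanh_mem_Ioo (p := p) (s := s) a x)
  positivity

lemma soliton_pos (hp : 1 < p) (hs : 0 < s) (x : ℝ) : 0 < soliton p s a x := by
  rw [soliton_eq]
  exact Real.rpow_pos_of_pos (soliton_base_pos a hp hs x) _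

lemma hasDerivAt_soliton (hp : 1 < p) (hs : 0 < s) (x : ℝ) :
    HasDerivAt (soliton p s a) (-(s * solitonTanh p s a x * soliton p s a x)) x := by
  have hD := soliton_base_pos a hp hs x
  have h1 := (((hasDerivAt_solitonTanh (p := p) (s := s) a x).pow 2).const_sub 1).const_mul
    ((p + 1) * s ^ 2 / 2)
  have h2 := h1.rpow_const (p := 1 / (p - 1)) (Or.inl hD.ne')
  have e : soliton p s a = fun x =>
    ((p + 1) * s ^ 2 / 2 * (1 - (solitonTanh p s a ^ 2) x)) ^ (1 / (p - 1)) :=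
    funext fun x => soliton_eq p s a x
  rw [← e] at h2
  refine h2.congr_deriv ?_
  have hp1 : p - 1 ≠ 0 := by linarith
  simp only [Pi.pow_apply]
  rw [Real.rpow_sub_one hD.ne', ← soliton_eq]
  have h3 := (one_sub_sq_pos (solitonTanh_mem_Ioo (p := p) (s := s) a x)).ne'
  have h4 : p + 1 ≠ 0 := by linarith
  norm_num
  field_simp

lemma continuous_soliton (hp : 1 < p) (hs : 0 < s) : Continuous (soliton p s a) :=
  continuous_iff_continuousAt.2 fun x => (hasDerivAt_soliton a hp hs x).continuousAt

lemma soliton_rpow_sub_one (hp : 1 < p) (hs : 0 < s) (x : ℝ) :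
    soliton p s a x ^ (p - 1) = (p + 1) * s ^ 2 / 2 * (1 - solitonTanh p s a x ^ 2) := by
  have hp1 : p - 1 ≠ 0 := by linarith
  rw [soliton_eq, ← Real.rpow_mul (soliton_base_pos a hp hs x).le, one_div_mul_cancel hp1,
    Real.rpow_one]

lemma soliton_rpow_add_one (hp : 1 < p) (hs : 0 < s) (x : ℝ) :
    soliton p s a x ^ (p + 1) =
      (p + 1) * s ^ 2 / 2 * (1 - solitonTanh p s a x ^ 2) * soliton p s a x ^ 2 := by
  rw [← soliton_rpow_sub_one a hp hs, ← Real.rpow_natCast, ← Real.rpow_add (soliton_pos a hp hs x)]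
  congr 1
  push_cast; ring

lemma soliton_le_exp (hp : 1 < p) (hs : 0 < s) (x : ℝ) :
    soliton p s a x ≤
      (2 * (p + 1) * s ^ 2 * Real.exp (-(2 * a))) ^ (1 / (p - 1)) * Real.exp (-(s * x)) := by
  have hp1 : 0 < p - 1 := by linarith
  set y := (p - 1) * s / 2 * x + a with hy
  have hc : 1 / Real.cosh y ≤ 2 * Real.exp (-y) := by
    rw [div_le_iff₀ (Real.cosh_pos y), Real.cosh_eq]
    have : Real.exp (-y) * Real.exp y = 1 := by rw [← Real.exp_add]; simp
    nlinarith [Real.exp_pos (-y)]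
  have hc0 : 0 < 1 / Real.cosh y := by have := Real.cosh_pos y; positivity
  have h1 : (p + 1) * s ^ 2 / 2 * (1 / Real.cosh y) ^ 2 ≤
      2 * (p + 1) * s ^ 2 * Real.exp (-(2 * a)) * Real.exp (-(p - 1) * s * x) := by
    calc _ ≤ (p + 1) * s ^ 2 / 2 * (2 * Real.exp (-y)) ^ 2 := by gcongr
      _ = 2 * (p + 1) * s ^ 2 * (Real.exp (-y) * Real.exp (-y)) := by ring
      _ = _ := by
        rw [← Real.exp_add, mul_assoc _ (Real.exp _) (Real.exp _), ← Real.exp_add, hy]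
        congr 2; ring
  rw [soliton]
  refine (Real.rpow_le_rpow (by positivity) h1 (by positivity)).trans_eq ?_
  rw [Real.mul_rpow (by positivity) (by positivity), ← Real.exp_mul]
  congr 2
  field_simp

lemma tendsto_soliton (hp : 1 < p) (hs : 0 < s) : Tendsto (soliton p s a) atTop (𝓝 0) := by
  refine squeeze_zero (fun x => (soliton_pos a hp hs x).le) (soliton_le_exp a hp hs) ?_
  have h : Tendsto (fun x : ℝ => Real.exp (-(s * x))) atTop (𝓝 0) :=
    Real.tendsto_exp_neg_atTop_nhds_zero.comp (tendsto_id.const_mul_atTop hs)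
  simpa using h.const_mul ((2 * (p + 1) * s ^ 2 * Real.exp (-(2 * a))) ^ (1 / (p - 1)))

lemma integrableOn_soliton_sq (hp : 1 < p) (hs : 0 < s) :
    IntegrableOn (fun x => soliton p s a x ^ 2) (Ioi 0) := by
  set C := (2 * (p + 1) * s ^ 2 * Real.exp (-(2 * a))) ^ (1 / (p - 1)) with hC
  have h : IntegrableOn (fun x : ℝ => C ^ 2 * Real.exp (-(2 * s) * x)) (Ioi 0) :=
    (exp_neg_integrableOn_Ioi 0 (by positivity)).const_mul _
  refine Integrable.mono' h ((continuous_soliton a hp hs).pow 2).aestronglyMeasurable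
    (Eventually.of_forall fun x => ?_)
  rw [Real.norm_of_nonneg (by positivity)]
  refine (pow_le_pow_left₀ (soliton_pos a hp hs x).le (soliton_le_exp a hp hs x) 2).trans_eq ?_
  rw [mul_pow, ← hC, ← Real.exp_nat_mul]
  congr 2; push_cast; ring

lemma integrableOn_mul_soliton_sq (hp : 1 < p) (hs : 0 < s) {k : ℝ → ℝ} (hk : Continuous k)
    {B : ℝ} (hB : ∀ x, |k x| ≤ B) : IntegrableOn (fun x => k x * soliton p s a x ^ 2) (Ioi 0) :=
  (integrableOn_soliton_sq a hp hs).bdd_mul hk.aestronglyMeasurable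
    (Eventually.of_forall hB)

lemma solitonTanh_sq_le (x : ℝ) : solitonTanh p s a x ^ 2 ≤ 1 := by
  have := one_sub_sq_pos (solitonTanh_mem_Ioo (p := p) (s := s) a x)
  linarith

lemma integrableOn_soliton_rpow (hp : 1 < p) (hs : 0 < s) :
    IntegrableOn (fun x => soliton p s a x ^ (p + 1)) (Ioi 0) := by
  simp only [soliton_rpow_add_one a hp hs]
  refine integrableOn_mul_soliton_sq a hp hs (B := (p + 1) * s ^ 2 / 2) ?_ fun x => ?_
  · have := continuous_solitonTanh (p := p) (s := s) a
    fun_prop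
  · have h := one_sub_sq_pos (solitonTanh_mem_Ioo (p := p) (s := s) a x)
    rw [abs_of_pos (soliton_base_pos a hp hs x)]
    exact mul_le_of_le_one_right (by positivity) (by nlinarith)

lemma integrableOn_solitonTanh_sq (hp : 1 < p) (hs : 0 < s) :
    IntegrableOn (fun x => (s * solitonTanh p s a x * soliton p s a x) ^ 2) (Ioi 0) := by
  have e : (fun x => (s * solitonTanh p s a x * soliton p s a x) ^ 2) = fun x =>
    (s ^ 2 * solitonTanh p s a x ^ 2) * soliton p s a x ^ 2 := funext fun x => by ring
  rw [e]
  refine integrableOn_mul_soliton_sq a hp hs (B := s ^ 2) ?_ fun x => ?_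
  · have := continuous_solitonTanh (p := p) (s := s) a
    fun_prop
  · rw [abs_of_nonneg (by positivity)]
    exact mul_le_of_le_one_right (by positivity) (solitonTanh_sq_le a x)

/-- Substituting r = `solitonTanh` turns the mass into the tail integral: φ^(p+1) is proportional to
(1 − r²)^α and dx = dr/(b(1 − r²)). The proof checks the resulting antiderivative. -/
lemma integral_soliton_rpow (hp : 1 < p) (hs : 0 < s) :
    ∫ x in Ioi 0, soliton p s a x ^ (p + 1) =
      soliton p s a 0 ^ (p + 1) *
        (tailRatio ((p + 1) / (p - 1)) (Real.tanh a) / ((p - 1) * s / 2)) := by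
  have hp1 : 0 < p - 1 := by linarith
  have hα : 1 < (p + 1) / (p - 1) := by rw [lt_div_iff₀ hp1]; linarith
  set α := (p + 1) / (p - 1) with hαd
  set b := (p - 1) * s / 2 with hb
  have hb0 : 0 < b := by positivity
  set F : ℝ → ℝ := fun x => soliton p s a x ^ (p + 1) * (tailRatio α (solitonTanh p s a x) / b)
    with hF
  have hd : ∀ x, HasDerivAt F (-(soliton p s a x ^ (p + 1))) x := fun x => by
    have hx := soliton_pos a hp hs x
    have hT := solitonTanh_mem_Ioo (p := p) (s := s) a x
    have h1 := ((hasDerivAt_soliton a hp hs x).rpow_const (p := p + 1) (Or.inl hx.ne')).mul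
      (((hasDerivAt_tailRatio hα hT).comp x (hasDerivAt_solitonTanh a x)).div_const b)
    refine h1.congr_deriv ?_
    have e : soliton p s a x ^ (p + 1 - 1) = soliton p s a x ^ (p + 1) / soliton p s a x :=
      Real.rpow_sub_one hx.ne' _
    have h0 := (one_sub_sq_pos hT).ne'
    rw [e, ← hb]
    simp only [Function.comp]
    generalize tailRatio α (solitonTanh p s a x) = N
    generalize soliton p s a x ^ (p + 1) = Z
    have e2 : (p + 1) * s = 2 * α * b := by rw [hαd, hb]; field_simp
    field_simp
    linear_combination (-(Z * solitonTanh p s a x * N)) * e2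
  -- For x ≥ 0 the tail ratio is at most its value at x = 0, so the decay of the soliton suffices.
  have hlim : Tendsto F atTop (𝓝 0) := by
    have h1 : Tendsto (fun x => soliton p s a x ^ (p + 1) *
        (tailRatio α (Real.tanh a) / b)) atTop (𝓝 0) := by
      have := ((tendsto_soliton a hp hs).rpow_const (p := p + 1)
        (Or.inr (by linarith))).mul_const (tailRatio α (Real.tanh a) / b)
      simpa [Real.zero_rpow (by linarith : p + 1 ≠ 0)] using this
    refine squeeze_zero' (Eventually.of_forall fun x => ?_) ?_ h1
    · have h2 := tailRatio_pos hα (solitonTanh_mem_Ioo (p := p) (s := s) a x)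
      have h3 := Real.rpow_pos_of_pos (soliton_pos a hp hs x) (p + 1)
      simp only [hF]; positivity
    · filter_upwards [eventually_ge_atTop 0] with x hx
      have h3 := Real.rpow_pos_of_pos (soliton_pos a hp hs x) (p + 1)
      have h4 : tailRatio α (solitonTanh p s a x) ≤ tailRatio α (Real.tanh a) := by
        apply (strictAntiOn_tailRatio hα).antitoneOn (tanh_mem_Ioo a) (solitonTanh_mem_Ioo a x)
        exact monotone_tanh (by have : 0 ≤ (p - 1) * s / 2 * x := by positivity
                                linarith)
      simp only [hF]
      gcongr
  have h := integral_Ioi_of_hasDerivAt_of_tendsto' (a := 0) (fun x _ => hd x)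
    (integrableOn_soliton_rpow a hp hs).neg hlim
  rw [integral_neg] at h
  simp only [hF, solitonTanh_zero] at h
  linarith

/-- The function sTφ² is an antiderivative of φ^(p+1) − φ'² − s²φ². Its value at 0 is the boundary
term, and it vanishes at infinity. -/
lemma soliton_energy_identity (hp : 1 < p) (hs : 0 < s) :
    (∫ x in Ioi 0, (s * solitonTanh p s a x * soliton p s a x) ^ 2) +
      s ^ 2 * (∫ x in Ioi 0, soliton p s a x ^ 2) - s * Real.tanh a * soliton p s a 0 ^ 2 =
      ∫ x in Ioi 0, soliton p s a x ^ (p + 1) := by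
  set P : ℝ → ℝ := fun x => s * (solitonTanh p s a x * soliton p s a x ^ 2) with hP
  have hd : ∀ x, HasDerivAt P (soliton p s a x ^ (p + 1) -
      ((s * solitonTanh p s a x * soliton p s a x) ^ 2 + s ^ 2 * soliton p s a x ^ 2)) x :=
    fun x => by
    have h := ((hasDerivAt_solitonTanh (p := p) (s := s) a x).mul
      ((hasDerivAt_soliton a hp hs x).pow 2)).const_mul s
    refine h.congr_deriv ?_
    rw [soliton_rpow_add_one a hp hs]
    simp only [Pi.pow_apply]
    norm_num
    ring
  have hlim : Tendsto P atTop (𝓝 0) := by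
    have h1 := ((tendsto_soliton a hp hs).pow 2).const_mul s
    have h2 : Tendsto (fun x => ‖P x‖) atTop (𝓝 0) := by
      refine squeeze_zero (fun x => norm_nonneg _) (fun x => ?_) (by simpa using h1)
      have h3 := solitonTanh_mem_Ioo (p := p) (s := s) a x
      rw [hP, norm_mul, norm_mul, Real.norm_of_nonneg hs.le,
        Real.norm_of_nonneg (sq_nonneg (soliton p s a x))]
      have : ‖solitonTanh p s a x‖ ≤ 1 := abs_le.2 ⟨h3.1.le, h3.2.le⟩
      gcongr
      exact mul_le_of_le_one_left (by positivity) this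
    exact tendsto_zero_iff_norm_tendsto_zero.2 h2
  have i1 := integrableOn_soliton_rpow a hp hs
  have i2 := integrableOn_solitonTanh_sq a hp hs
  have i3 := (integrableOn_soliton_sq a hp hs).const_mul (s ^ 2)
  have h := integral_Ioi_of_hasDerivAt_of_tendsto' (a := 0) (fun x _ => hd x)
    (i1.sub (i2.add i3)) hlim
  have e : ∫ x in Ioi 0, (soliton p s a x ^ (p + 1) -
      ((s * solitonTanh p s a x * soliton p s a x) ^ 2 + s ^ 2 * soliton p s a x ^ 2)) =
      (∫ x in Ioi 0, soliton p s a x ^ (p + 1)) -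
      ((∫ x in Ioi 0, (s * solitonTanh p s a x * soliton p s a x) ^ 2) +
        s ^ 2 * ∫ x in Ioi 0, soliton p s a x ^ 2) := by
    have i23 : IntegrableOn (fun x => (s * solitonTanh p s a x * soliton p s a x) ^ 2 +
        s ^ 2 * soliton p s a x ^ 2) (Ioi 0) := i2.add i3
    rw [integral_sub i1 i23, integral_add i2 i3, integral_const_mul]
  rw [e] at h
  simp only [hP, solitonTanh_zero] at h
  linarith

/-- Inserting the exact mass and φ(0)^(p−1) = (p+1)s²(1 − t²)/2, with t = tanh a, matches the
calibration constant with the mass to the power (p−1)/(p+1). -/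
lemma halfLineConst_eq (hp : 1 < p) (hs : 0 < s) :
    halfLineConst p s (Real.tanh a) =
      (∫ x in Ioi 0, soliton p s a x ^ (p + 1)) ^ ((p - 1) / (p + 1)) := by
  have hp1 : 0 < p - 1 := by linarith
  have hpp : 0 < p + 1 := by linarith
  have hα : 1 < (p + 1) / (p - 1) := by rw [lt_div_iff₀ hp1]; linarith
  have hN := tailRatio_pos hα (tanh_mem_Ioo a)
  have hφ := soliton_pos a hp hs 0
  have hb : 0 < (p - 1) * s / 2 := by positivity
  rw [integral_soliton_rpow a hp hs, Real.mul_rpow (by positivity) (by positivity),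
    ← Real.rpow_mul hφ.le, mul_div_cancel₀ _ hpp.ne', soliton_rpow_sub_one a hp hs,
    solitonTanh_zero, Real.div_rpow hN.le hb.le, halfLineConst, one_div_div]
  have e : ((p - 1) * s / 2) ^ (2 / (p + 1)) =
      ((p - 1) * s / 2) / ((p - 1) * s / 2) ^ ((p - 1) / (p + 1)) := by
    have : 2 / (p + 1) = 1 - (p - 1) / (p + 1) := by field_simp; ring
    rw [this, Real.rpow_sub hb, Real.rpow_one]
  rw [e]
  field_simp

/-! ### The even soliton on the line. -/

/-- The even extension of the soliton to the line. -/
noncomputable def evenSoliton (p s a x : ℝ) : ℂ := (soliton p s a |x| : ℝ)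

/-- The derivative of the even extension of the soliton. -/
noncomputable def evenSolitonDeriv (p s a x : ℝ) : ℂ :=
  ((if 0 < x then -1 else 1) * (s * solitonTanh p s a |x| * soliton p s a |x|) : ℝ)

lemma norm_evenSoliton (hp : 1 < p) (hs : 0 < s) (x : ℝ) :
    ‖evenSoliton p s a x‖ = soliton p s a |x| := by
  rw [evenSoliton, Complex.norm_real, Real.norm_of_nonneg (soliton_pos a hp hs _).le]

lemma norm_evenSolitonDeriv_sq (x : ℝ) :
    ‖evenSolitonDeriv p s a x‖ ^ 2 = (s * solitonTanh p s a |x| * soliton p s a |x|) ^ 2 := by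
  rw [evenSolitonDeriv, Complex.norm_real, Real.norm_eq_abs, sq_abs]
  split_ifs <;> ring

lemma continuous_evenSoliton (hp : 1 < p) (hs : 0 < s) : Continuous (evenSoliton p s a) :=
  Complex.continuous_ofReal.comp ((continuous_soliton a hp hs).comp continuous_abs)

lemma integrable_comp_abs {h : ℝ → ℝ} (hi : IntegrableOn h (Ioi 0)) :
    Integrable fun x => h |x| := by
  refine integrable_of_even (fun x => by rw [abs_neg]) (hi.congr_fun (fun x hx => ?_)
    measurableSet_Ioi)
  rw [abs_of_pos hx]

lemma memLp_evenSoliton (hp : 1 < p) (hs : 0 < s) : MemLp (evenSoliton p s a) 2 volume := by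
  rw [memLp_two_iff_integrable_sq_norm (continuous_evenSoliton a hp hs).aestronglyMeasurable]
  simp only [norm_evenSoliton a hp hs]
  exact integrable_comp_abs (integrableOn_soliton_sq a hp hs)

lemma measurable_evenSolitonDeriv (hp : 1 < p) (hs : 0 < s) :
    Measurable (evenSolitonDeriv p s a) := by
  have h1 := (continuous_soliton a hp hs).measurable
  have h2 := (continuous_solitonTanh (p := p) (s := s) a).measurable
  have h3 : Measurable fun x : ℝ => if 0 < x then (-1 : ℝ) else 1 :=
    Measurable.ite measurableSet_Ioi measurable_const measurable_const
  have h4 : Measurable fun x : ℝ => |x| := continuous_abs.measurable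
  exact Complex.measurable_ofReal.comp (h3.mul ((measurable_const.mul (h2.comp h4)).mul (h1.comp h4)))

lemma memLp_evenSolitonDeriv (hp : 1 < p) (hs : 0 < s) :
    MemLp (evenSolitonDeriv p s a) 2 volume := by
  rw [memLp_two_iff_integrable_sq_norm (measurable_evenSolitonDeriv a hp hs).aestronglyMeasurable]
  simp only [norm_evenSolitonDeriv_sq]
  exact integrable_comp_abs (integrableOn_solitonTanh_sq a hp hs)

lemma evenSoliton_eq_primitive (hp : 1 < p) (hs : 0 < s) :
    evenSoliton p s a = primitive (soliton p s a 0 : ℝ) (evenSolitonDeriv p s a) := by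
  funext x
  have hi := intervalIntegrable_of_locallyIntegrable
    ((memLp_evenSolitonDeriv a hp hs).locallyIntegrable (by norm_num))
  have hd : ∀ y, y ≠ 0 → HasDerivAt (evenSoliton p s a) (evenSolitonDeriv p s a y) y := by
    intro y hy
    have h1 := ((hasDerivAt_soliton a hp hs |y|).comp y (hasDerivAt_abs hy)).ofReal_comp
    refine h1.congr_deriv ?_
    rw [evenSolitonDeriv]
    congr 1
    rcases lt_or_gt_of_ne hy with h | h
    · rw [if_neg (not_lt.2 h.le)]; simp [h]
    · rw [if_pos h]; simp [h]
  -- The corner at 0 is a single exceptional point, so continuity suffices there.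
  have h := MeasureTheory.integral_eq_of_hasDerivAt_off_countable (evenSoliton p s a)
    (evenSolitonDeriv p s a) (a := 0) (b := x) (countable_singleton 0)
    (continuous_evenSoliton a hp hs).continuousOn (fun y hy => hd y hy.2) (hi 0 x)
  rw [primitive, h]
  simp [evenSoliton]

lemma memH1Even_evenSoliton (hp : 1 < p) (hs : 0 < s) : MemH1Even (evenSoliton p s a) := by
  have h := evenSoliton_eq_primitive a hp hs
  have h2 := memLp_evenSoliton a hp hs
  refine ⟨?_, Eventually.of_forall fun x => by simp [evenSoliton]⟩
  rw [h] at h2 ⊢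
  exact memH1_primitive (memLp_evenSolitonDeriv a hp hs) h2

lemma integral_evenSoliton_rpow (hp : 1 < p) (hs : 0 < s) :
    ∫ x, ‖evenSoliton p s a x‖ ^ (p + 1) = 2 * ∫ x in Ioi 0, soliton p s a x ^ (p + 1) := by
  simp only [norm_evenSoliton a hp hs]
  exact integral_comp_abs (f := fun x => soliton p s a x ^ (p + 1))

lemma integral_evenSoliton_rpow_pos (hp : 1 < p) (hs : 0 < s) :
    0 < ∫ x, ‖evenSoliton p s a x‖ ^ (p + 1) := by
  have hp1 : 0 < p - 1 := by linarith
  have hα : 1 < (p + 1) / (p - 1) := by rw [lt_div_iff₀ hp1]; linarith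
  have hN := tailRatio_pos hα (tanh_mem_Ioo a)
  have hφ := soliton_pos a hp hs 0
  rw [integral_evenSoliton_rpow a hp hs, integral_soliton_rpow a hp hs]
  positivity

lemma energyNormSq_evenSoliton (hp : 1 < p) (hs : 0 < s) :
    energyNormSq (s ^ 2) (2 * s * Real.tanh a) (evenSoliton p s a) =
      ∫ x, ‖evenSoliton p s a x‖ ^ (p + 1) := by
  have h := evenSoliton_eq_primitive a hp hs
  rw [energyNormSq_of_ae_eq_primitive (memLp_evenSolitonDeriv a hp hs) (Eventually.of_forall
    fun x => congrFun h x), ← h, integral_evenSoliton_rpow a hp hs,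
    ← soliton_energy_identity a hp hs]
  simp only [norm_evenSolitonDeriv_sq, norm_evenSoliton a hp hs]
  rw [integral_comp_abs (f := fun x => (s * solitonTanh p s a x * soliton p s a x) ^ 2),
    integral_comp_abs (f := fun x => soliton p s a x ^ 2), Complex.norm_real,
    Real.norm_of_nonneg (soliton_pos a hp hs 0).le]
  ring

end soliton

/-! ### Matching parameters and assembling the sharp constant. -/

lemma groundState_eq_evenSoliton {p ω γ : ℝ} (hω : 0 ≤ ω) :
    groundState p ω γ = evenSoliton p √ω (Real.artanh (γ / (2 * √ω))) := by
  funext x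
  rw [groundState, evenSoliton, soliton, Real.sq_sqrt hω]

lemma boundarySlope_mem_Ioo {ω γ : ℝ} (hω : γ ^ 2 / 4 < ω) : γ / (2 * √ω) ∈ Ioo (-1 : ℝ) 1 := by
  have hω0 : 0 < ω := lt_of_le_of_lt (by positivity) hω
  have h : |γ| < 2 * √ω := by
    apply abs_lt_of_sq_lt_sq _ (by positivity)
    rw [mul_pow, Real.sq_sqrt hω0.le]; linarith
  have h2 := abs_lt.1 h
  have hs : 0 < 2 * √ω := by positivity
  exact ⟨by rw [lt_div_iff₀ hs]; linarith, by rw [div_lt_one hs]; exact h2.2⟩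

lemma normL_eq {f : ℝ → ℂ} (hf : AEStronglyMeasurable f volume) {q : ℝ} (hq : 0 < q) :
    normL q f = (∫ x, ‖f x‖ ^ q) ^ (1 / q) := by
  have h : 0 ≤ normL q f := lpNorm_nonneg
  rw [← normL_rpow hf hq, ← Real.rpow_mul h, mul_one_div_cancel hq.ne', Real.rpow_one]

lemma normL_rpow_eq {f : ℝ → ℂ} (hf : AEStronglyMeasurable f volume) {q : ℝ} (hq : 0 < q)
    (r : ℝ) : normL q f ^ r = (∫ x, ‖f x‖ ^ q) ^ (r / q) := by
  rw [normL_eq hf hq, ← Real.rpow_mul (integral_nonneg fun x => by positivity)]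
  congr 1; ring

lemma normL_sq_eq {f : ℝ → ℂ} (hf : AEStronglyMeasurable f volume) {q : ℝ} (hq : 0 < q) :
    normL q f ^ 2 = (∫ x, ‖f x‖ ^ q) ^ (2 / q) := by
  rw [← normL_rpow_eq hf hq, Real.rpow_two]

/-- The sharp inequality for even functions, with the constant in terms of the even soliton. -/
lemma normL_sq_le_energyNormSq {p s : ℝ} (a : ℝ) (hp : 1 < p) (hs : 0 < s) {f : ℝ → ℂ}
    (hf : MemH1Even f) :
    normL (p + 1) f ^ 2 ≤ ((∫ x, ‖evenSoliton p s a x‖ ^ (p + 1)) ^ ((p - 1) / (p + 1)))⁻¹ *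
      energyNormSq (s ^ 2) (2 * s * Real.tanh a) f := by
  have hpp : 0 < p + 1 := by linarith
  obtain ⟨hm, h⟩ := even_inequality hp hs (tanh_mem_Ioo a) hf
  have hX := integral_evenSoliton_rpow_pos a hp hs
  have e := integral_evenSoliton_rpow a hp hs
  rw [halfLineConst_eq a hp hs] at h
  set X := ∫ x, ‖evenSoliton p s a x‖ ^ (p + 1)
  have e' : ∫ x in Ioi 0, soliton p s a x ^ (p + 1) = X / 2 := by linarith
  have hY : 0 ≤ ∫ x, ‖f x‖ ^ (p + 1) := integral_nonneg fun x => by positivity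
  rw [e'] at h
  rw [normL_sq_eq hm.aestronglyMeasurable hpp, inv_mul_eq_div,
    le_div_iff₀ (Real.rpow_pos_of_pos hX _)]
  refine le_trans (le_of_eq ?_) h
  rw [Real.div_rpow hX.le two_pos.le, Real.div_rpow hY two_pos.le]
  -- Halving both masses costs 2 to the powers (p−1)/(p+1) and 2/(p+1), which exactly absorb the
  -- factor 2 from the two half-lines.
  have e2 : (2 : ℝ) ^ ((p - 1) / (p + 1)) * 2 ^ (2 / (p + 1)) = 2 := by
    rw [← Real.rpow_add two_pos, ← add_div]
    have : (p - 1 + 2) / (p + 1) = 1 := by field_simp; ring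
    rw [this, Real.rpow_one]
  have h1 := Real.rpow_pos_of_pos (two_pos (α := ℝ)) ((p - 1) / (p + 1))
  have h2 := Real.rpow_pos_of_pos (two_pos (α := ℝ)) (2 / (p + 1))
  field_simp
  linear_combination
    (∫ x, ‖f x‖ ^ (p + 1)) ^ (2 / (p + 1)) * e2

end DeltaNLS

theorem mainTheorem9 (p ω γ : ℝ) (hp : 5 < p) (hγ : γ < 0) (hω : γ ^ 2 / 4 < ω) :
    (∀ f : ℝ → ℂ, DeltaNLS.MemH1Even f → MemLp f (ENNReal.ofReal (p + 1)) volume) ∧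
    DeltaNLS.MemH1Even (DeltaNLS.groundState p ω γ) ∧
    ∃ C : ℝ, 0 < C ∧
      IsLeast (DeltaNLS.admissibleConstants p ω γ) C ∧
      DeltaNLS.normL (p + 1) (DeltaNLS.groundState p ω γ) ^ 2 =
        C * DeltaNLS.energyNormSq ω γ (DeltaNLS.groundState p ω γ) ∧
      C⁻¹ = DeltaNLS.energyNormSq ω γ (DeltaNLS.groundState p ω γ) /
        DeltaNLS.normL (p + 1) (DeltaNLS.groundState p ω γ) ^ 2 ∧
      C⁻¹ = (2 * (p + 1) / (p - 1) * DeltaNLS.action p ω γ (DeltaNLS.groundState p ω γ)) ^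
        ((p - 1) / (p + 1)) ∧
      C⁻¹ = DeltaNLS.normL (p + 1) (DeltaNLS.groundState p ω γ) ^ (p - 1) := by
  open DeltaNLS in
  have hω0 : 0 < ω := lt_of_le_of_lt (by positivity) hω
  have hp1 : 1 < p := by linarith
  have hpp : 0 < p + 1 := by linarith
  have hpm : 0 < p - 1 := by linarith
  have hs : 0 < √ω := Real.sqrt_pos.2 hω0
  have ht := boundarySlope_mem_Ioo hω
  set a := Real.artanh (γ / (2 * √ω)) with ha
  have hta : Real.tanh a = γ / (2 * √ω) := Real.tanh_artanh ht
  have hs2 : √ω ^ 2 = ω := Real.sq_sqrt hω0.le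
  have hγ2 : 2 * √ω * Real.tanh a = γ := by rw [hta]; field_simp
  have hQ : groundState p ω γ = evenSoliton p √ω a := groundState_eq_evenSoliton hω0.le
  have hmem := memH1Even_evenSoliton a hp1 hs
  have hmeas := (continuous_evenSoliton a hp1 hs).aestronglyMeasurable (μ := volume)
  have hX := integral_evenSoliton_rpow_pos a hp1 hs
  have hE := energyNormSq_evenSoliton a hp1 hs
  have hle := fun f (hf : MemH1Even f) => normL_sq_le_energyNormSq a hp1 hs hf
  have hn2 := normL_sq_eq hmeas hpp
  have hnp := normL_rpow hmeas hpp
  have hnm := normL_rpow_eq hmeas hpp (p - 1)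
  rw [hs2, hγ2] at hE
  simp only [hs2, hγ2] at hle
  rw [hQ]
  set X := ∫ x, ‖evenSoliton p √ω a x‖ ^ (p + 1) with hXd
  have hmul : X ^ (2 / (p + 1)) * X ^ ((p - 1) / (p + 1)) = X := by
    rw [← Real.rpow_add hX, ← add_div]
    have : (2 + (p - 1)) / (p + 1) = 1 := by field_simp; ring
    rw [this, Real.rpow_one]
  have hK := Real.rpow_pos_of_pos hX ((p - 1) / (p + 1))
  have hN := Real.rpow_pos_of_pos hX (2 / (p + 1))
  have heq : normL (p + 1) (evenSoliton p √ω a) ^ 2 =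
      (X ^ ((p - 1) / (p + 1)))⁻¹ * energyNormSq ω γ (evenSoliton p √ω a) := by
    rw [hn2, hE, inv_mul_eq_div, eq_div_iff hK.ne', hmul]
  -- Energy norm and mass both equal X, so the action is (1/2 − 1/(p+1))X.
  have haction : 2 * (p + 1) / (p - 1) * action p ω γ (evenSoliton p √ω a) = X := by
    have h1 : action p ω γ (evenSoliton p √ω a) =
        1 / 2 * energyNormSq ω γ (evenSoliton p √ω a) -
          1 / (p + 1) * normL (p + 1) (evenSoliton p √ω a) ^ (p + 1) := by
      rw [action, energy, mass, energyNormSq]; ring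
    rw [h1, hE, hnp]
    field_simp
    ring
  refine ⟨fun f hf => (even_inequality hp1 hs ht hf).1, hmem, (X ^ ((p - 1) / (p + 1)))⁻¹,
    inv_pos.2 hK, ⟨hle, fun C hC => ?_⟩, heq, ?_, ?_, ?_⟩
  -- Minimality: test with the ground state, whose energy X > 0 can be cancelled.
  · have h := hC _ hmem
    rw [heq, hE] at h
    exact le_of_mul_le_mul_right h hX
  · rw [inv_inv, hE, hn2, eq_div_iff hN.ne', mul_comm, hmul]
  · rw [inv_inv, haction]
  · rw [inv_inv, hnm]
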